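/- **Setting.** A $(k,n)$-coding scheme is a pair of a randomised encoder $\mathsf{Enc}:\{0,1\}^k\to\{0,1\}^n$ and a deterministic decoder $\mathsf{Dec}:\{0,1\}^n\to\{0,1\}^k\cup\{\bot\}$ with $\Pr[\mathsf{Dec}(\mathsf{Enc}(m))=m]=1$ for all $m$; its rate is $k/n$. Let $0\le\rho_r,\rho_w\le 1$. The family $\mathcal F^{[n],\rho_r,\rho_w}_{\mathrm{BIT}}$ consists of all functions $f_{S_r,S_w,g}:\{0,1\}^n\to\{0,1\}^n$, where $S_r,S_w\subseteq[n]$ have sizes $n\rho_r$ and $n\rho_w$ (rounded down if not integers) and $g$ maps each $\alpha\in\{0,1\}^{S_r}$ to a vector $g(\alpha)\in\{\mathsf{Set0},\mathsf{Set1},\mathsf{Keep},\mathsf{Flip}\}^{S_w}$ of one-bit functions; $f_{S_r,S_w,g}(x)$ is obtained from $x$ by applying $g(x_{S_r})_i$ to the bit $x_i$ for each $i\in S_w$ and leaving the other bits unchanged. A coding scheme is non-malleable with respect to a family $\mathcal F$ with error $\varepsilon$ if for each $f\in\mathcal F$ there is a distribution $\mathcal D_f$ on $\{0,1\}^k\cup\{\bot,\mathsf{same}^*\}$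 such that for every message $m$ the statistical distance between $\mathsf{Dec}(f(\mathsf{Enc}(m)))$ and $\mathrm{Patch}(\mathcal D_f,m)$ is at most $\varepsilon$, where $\mathrm{Patch}(\mathcal D_f,m)$ is a sample from $\mathcal D_f$ with $\mathsf{same}^*$ replaced by $m$. The capacity is the supremum of $\limsup_{k\to\infty}k/n(k)$ over all families $(C_k)_{k\ge 0}$ of $(k,n(k))$-coding schemes such that $C_k$ is non-malleable with respect to $\mathcal F^{[n(k)],\rho_r,\rho_w}_{\mathrm{BIT}}$ with error $\varepsilon(k)\to 0$ (the supremum of the empty set being $0$). The strict capacity is the supremum of $\liminf_{k\to\infty}k/n(k)$ over those families for which, in addition, $\varepsilon(k)$ is negligible in $k$ (decays faster than every inverse polynomial) and, for each $k$, all the $\mathcal D_f$ are sampled by one randomised algorithm that has only oracle access to $f$ and makes at most $p(n(k))$ queries, for some fixed polynomial $p$. **Theorem.** If $0\le\rho_r\le\rho_w\le1$, then the capacity is $1-\rho_r$, and the strict capacity is also $1-\rho_r$. -/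

import Mathlib

open Filter Topology
open scoped ENNReal

namespace BitNMC

noncomputable section

/-- Binary words of length `n`. -/
abbrev Word (n : ℕ) : Type := Fin n → Bool

/-- A `(k, n)`-coding scheme: a randomised encoder, a deterministic decoder whose value `none`
stands for `⊥`, and correctness: every word that `enc m` outputs with positive probability
decodes to `m` (that is, `dec (enc m) = m` with probability one). -/
structure CodingScheme (k n : ℕ) where
  enc : Word k → PMF (Word n)
  dec : Word n → Option (Word k)
  correct : ∀ m : Word k, ∀ x ∈ (enc m).support, dec x = some m

/-- Statistical (total variation) distance of two distributions on a finite set. -/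
def statDist {α : Type} [Fintype α] (p q : PMF α) : ℝ :=
  (1 / 2) * ∑ a, |(p a).toReal - (q a).toReal|

/-- The set `{0,1}^k ∪ {⊥, same*}`: `none` is `same*`, `some none` is `⊥`, and
`some (some m)` is the message `m`. -/
abbrev SimOutcome (k : ℕ) : Type := Option (Option (Word k))

/-- The tampering experiment: encode `m`, apply `f`, decode. -/
def tamperExp {k n : ℕ} (C : CodingScheme k n) (f : Word n → Word n) (m : Word k) :
    PMF (Option (Word k)) :=
  (C.enc m).map (fun x => C.dec (f x))

/-- Draw from `D`; output `m` if the result is `same*`, and the result itself otherwise. -/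
def patch {k : ℕ} (D : PMF (SimOutcome k)) (m : Word k) : PMF (Option (Word k)) :=
  D.map (fun o => o.getD (some m))

/-- (Default) non-malleability with respect to the family `F`, with exact security `ε`. -/
def IsNonMalleable {k n : ℕ} (C : CodingScheme k n) (F : Set (Word n → Word n)) (ε : ℝ) : Prop :=
  ∀ f ∈ F, ∃ D : PMF (SimOutcome k), ∀ m : Word k, statDist (tamperExp C f m) (patch D m) ≤ ε

/-- Deterministic algorithms that query an oracle `X → X` adaptively and return an element
of `O`. -/
inductive OracleAlg (X O : Type) : Type
  | output (o : O) : OracleAlg X O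
  | query (x : X) (next : X → OracleAlg X O) : OracleAlg X O

/-- The result of running an oracle algorithm with the oracle `f`. -/
def OracleAlg.run {X O : Type} (f : X → X) : OracleAlg X O → O
  | .output o => o
  | .query x next => (next (f x)).run f

/-- The algorithm makes at most `q` queries, whatever the answers are. -/
def OracleAlg.QueriesAtMost {X O : Type} : OracleAlg X O → ℕ → Prop
  | .output _, _ => True
  | .query _ _, 0 => False
  | .query _ next, q + 1 => ∀ y, (next y).QueriesAtMost q

/-- Non-malleability with exact security `ε` in which, moreover, the distributions `D_f`, `f ∈ F`,
are all sampled by one randomised algorithm (a distribution `A` on deterministic ones) that has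
only oracle access to `f` and makes at most `q` queries. -/
def IsSampledNonMalleable {k n : ℕ} (C : CodingScheme k n) (F : Set (Word n → Word n)) (ε : ℝ)
    (q : ℕ) : Prop :=
  ∃ A : PMF (OracleAlg (Word n) (SimOutcome k)),
    (∀ a ∈ A.support, a.QueriesAtMost q) ∧
    ∀ f ∈ F, ∀ m : Word k, statDist (tamperExp C f m) (patch (A.map (fun a => a.run f)) m) ≤ ε

/-- The four functions that tamper with one bit. -/
inductive BitTamper : Type
  | set0 | set1 | keep | flip

/-- The action of a one-bit tampering function. -/
def BitTamper.apply : BitTamper → Bool → Bool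
  | .set0, _ => false
  | .set1, _ => true
  | .keep, b => b
  | .flip, b => !b

/-- The tampering function `f_{S_r, S_w, g}`: it reads `x` on `Sr`, applies the vector
`g (x restricted to Sr)` of one-bit tampering functions to the positions in `Sw`, and leaves all
other positions unchanged. -/
def bitTamperFun {n : ℕ} (Sr Sw : Finset (Fin n)) (g : (Sr → Bool) → (Sw → BitTamper)) :
    Word n → Word n :=
  fun x i => if h : i ∈ Sw then (g (fun j => x j) ⟨i, h⟩).apply (x i) else x i

/-- The family of bit tampering functions with leakage: all `f_{S_r, S_w, g}` with
`|S_r| = ρr n` and `|S_w| = ρw n` (integer parts, when these are not integers). -/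
def tamperFamily (n : ℕ) (ρr ρw : ℝ) : Set (Word n → Word n) :=
  {f | ∃ (Sr Sw : Finset (Fin n)) (g : (Sr → Bool) → (Sw → BitTamper)),
    Sr.card = ⌊ρr * n⌋₊ ∧ Sw.card = ⌊ρw * n⌋₊ ∧ f = bitTamperFun Sr Sw g}

/-- A family of `(k, n k)`-coding schemes, one for each message length `k`, that is non-malleable
for bit tampering with leakage, with security error tending to `0`. -/
def IsNMCFamily (ρr ρw : ℝ) (n : ℕ → ℕ) (C : ∀ k, CodingScheme k (n k)) : Prop :=
  ∃ ε : ℕ → ℝ, Tendsto ε atTop (𝓝 0) ∧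
    ∀ k, IsNonMalleable (C k) (tamperFamily (n k) ρr ρw) (ε k)

/-- The same with the stricter requirements that the error is negligible in `k` and that the
distributions `D_f` are sampled with a number of oracle queries that is polynomial in `n k`. -/
def IsStrictNMCFamily (ρr ρw : ℝ) (n : ℕ → ℕ) (C : ∀ k, CodingScheme k (n k)) : Prop :=
  ∃ (ε : ℕ → ℝ) (p : Polynomial ℕ),
    Asymptotics.SuperpolynomialDecay atTop (fun k : ℕ => (k : ℝ)) ε ∧
    ∀ k, IsSampledNonMalleable (C k) (tamperFamily (n k) ρr ρw) (ε k) (p.eval (n k))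

/-- The capacity: the supremum, over all non-malleable families, of the upper limit of the rates
`k / n k`. -/
def capacity (ρr ρw : ℝ) : ℝ≥0∞ :=
  ⨆ (n : ℕ → ℕ) (C : ∀ k, CodingScheme k (n k)) (_ : IsNMCFamily ρr ρw n C),
    limsup (fun k : ℕ => (k : ℝ≥0∞) / (n k : ℝ≥0∞)) atTop

/-- The capacity in the strictest sense: the supremum, over all families that are non-malleable
in the stricter sense, of the lower limit of the rates `k / n k`. -/
def strictCapacity (ρr ρw : ℝ) : ℝ≥0∞ :=
  ⨆ (n : ℕ → ℕ) (C : ∀ k, CodingScheme k (n k)) (_ : IsStrictNMCFamily ρr ρw n C),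
    liminf (fun k : ℕ => (k : ℝ≥0∞) / (n k : ℝ≥0∞)) atTop

end

end BitNMC

/-!
The upper bound. Let `t = ⌊ρr n⌋`. Because `ρr ≤ ρw`, the adversary can read `t` positions, test
whether the bits there lie in a set `A`, and in that case overwrite them all by a fixed `w`. At most
`2 ^ (n - t)` messages are consistent with `w` on these positions; every other message survives
exactly when its codeword avoids `A`, and tampering never produces it from another message. Hence
non-malleability forces the distribution of the bits read to be almost the same for all such
messages (`restrictProb_sub_le`). But the bits read are consistent with at most `2 ^ (n - t)` messages, while
the bits read from an encoding of `m` are always consistent with `m`; averaging over `m`, this is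
impossible once `k ≥ n - t + 2` and the error is below `1 / 12` (`le_of_isNonMalleable`).

The lower bound. There are only `2 ^ O(n 2 ^ t)` tampering functions, and a random code is
non-malleable for all of them at once. The decoder is drawn at random, with independent values, each
message having density `p`; a message is encoded by a uniformly random codeword. The simulator
queries `f` at a uniformly random point `x` and outputs `same*` if `f x = x` and the decoded answer
otherwise, so one query is enough. To compare it with the tampering experiment for a fixed `f`, call
a point heavy if it has more than `2 ^ n / r` preimages; there are at most `r` heavy points. By
Chernoff bounds over all subsets of the labels (fixed, moved to the heavy point `y`, moved to a
light point), random codewords and random points have nearly the same labels. A light target is a codeword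
only with small probability: for random points this is a weighted Chernoff bound, and for random
codewords of `m` it follows by restricting to the `x` that leave a half cube `x i = b`, where the
values of the decoder at `x` and at `f x` are independent (`decoderMean_exp_moved_le`). The union
bound (`exists_isGoodDecoder`) succeeds with exponentially small error when `k + t ≤ (1 - δ) n`.

Expectations over the random decoder are finite weighted sums, and all tail bounds enter the union
bound through their exponential moments (`exists_forall_neg`).
-/

namespace BitNMC

/-! ### Finite distributions -/

lemma sum_toReal_eq_one {α : Type} [Fintype α] (p : PMF α) : ∑ a, (p a).toReal = 1 := by
  rw [← ENNReal.toReal_sum (fun a _ => p.apply_ne_top a), ← tsum_fintype (L := .unconditional _),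
    p.tsum_coe, ENNReal.toReal_one]

lemma map_apply_toReal {α β : Type} [Fintype α] [DecidableEq β] (p : PMF α) (g : α → β) (b : β) :
    (p.map g b).toReal = ∑ a, if g a = b then (p a).toReal else 0 := by
  classical
  rw [PMF.map_apply, tsum_fintype, ENNReal.toReal_sum]
  · refine Finset.sum_congr rfl fun a _ => ?_
    by_cases h : g a = b
    · simp [h]
    · rw [if_neg (Ne.symm h), if_neg h, ENNReal.toReal_zero]
  · intro a _
    split_ifs
    · exact p.apply_ne_top a
    · simp

lemma abs_sub_le_two_mul_statDist {α : Type} [Fintype α] (p q : PMF α) (a : α) :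
    |(p a).toReal - (q a).toReal| ≤ 2 * statDist p q := by
  have := Finset.single_le_sum (f := fun a => |(p a).toReal - (q a).toReal|)
    (fun _ _ => abs_nonneg _) (Finset.mem_univ a)
  unfold statDist
  linarith

lemma statDist_le_one {α : Type} [Fintype α] (p q : PMF α) : statDist p q ≤ 1 := by
  have h : ∑ a, |(p a).toReal - (q a).toReal| ≤ ∑ a, ((p a).toReal + (q a).toReal) := by
    refine Finset.sum_le_sum fun a _ => ?_
    rw [abs_le]
    constructor <;>
      linarith [ENNReal.toReal_nonneg (a := p a), ENNReal.toReal_nonneg (a := q a)]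
  rw [Finset.sum_add_distrib, sum_toReal_eq_one, sum_toReal_eq_one] at h
  unfold statDist
  linarith

lemma patch_apply_same {k : ℕ} (D : PMF (SimOutcome k)) (m : Word k) :
    (patch D m (some m)).toReal = (D none).toReal + (D (some (some m))).toReal := by
  unfold patch
  rw [map_apply_toReal, Fintype.sum_option]
  simp

lemma patch_apply_of_ne {k : ℕ} (D : PMF (SimOutcome k)) {m m' : Word k} (h : m ≠ m') :
    (patch D m (some m')).toReal = (D (some (some m'))).toReal := by
  unfold patch
  rw [map_apply_toReal, Fintype.sum_option]
  simp [h]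

/-! ### The upper bound on the rate -/

section UpperBound

variable {k n : ℕ}

/-- The restriction of a word to the positions in `S`. -/
def readBits (S : Finset (Fin n)) (x : Word n) : S → Bool := fun j => x j

open Classical in
/-- The messages that some word with the restriction `w` to `S` decodes to. -/
noncomputable def consistentMessages (C : CodingScheme k n) (S : Finset (Fin n)) (w : S → Bool) :
    Finset (Word k) :=
  {m | ∃ y : Word n, readBits S y = w ∧ C.dec y = some m}

open Classical in
/-- The probability that the restriction to `S` of an encoding of `m` lies in `A`. -/
noncomputable def restrictProb (C : CodingScheme k n) (S : Finset (Fin n)) (m : Word k)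
    (A : Finset (S → Bool)) : ℝ :=
  ∑ x, if readBits S x ∈ A then (C.enc m x).toReal else 0

/-- A word with a given restriction to `S` is determined by its values outside `S`. -/
lemma card_consistentMessages_le (C : CodingScheme k n) (S : Finset (Fin n)) (w : S → Bool) :
    (consistentMessages C S w).card ≤ 2 ^ (n - S.card) := by
  classical
  have h1 : ((Finset.univ : Finset ({i // i ∉ S} → Bool)).image
      fun z => C.dec fun i => if h : i ∈ S then w ⟨i, h⟩ else z ⟨i, h⟩).card
        ≤ 2 ^ (n - S.card) := by
    refine Finset.card_image_le.trans (le_of_eq ?_)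
    simp [Fintype.card_subtype_compl]
  refine le_trans ?_ h1
  refine Finset.card_le_card_of_injOn some ?_ (Option.some_injective _).injOn
  intro m hm
  simp only [consistentMessages, Finset.coe_filter, Finset.mem_univ, true_and,
    Set.mem_ofPred_eq] at hm
  obtain ⟨y, hy, hd⟩ := hm
  simp only [Finset.coe_image, Finset.coe_univ, Set.image_univ, Set.mem_range]
  refine ⟨fun i => y i, ?_⟩
  rw [← hd]
  congr 1
  funext i
  split_ifs with h
  · rw [← hy]; rfl
  · rfl

open Classical in
/-- The tampering vector that overwrites the restriction to `Sr` by `w` if it lies in `A`, and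
keeps all bits otherwise. -/
noncomputable def overwriteVector {Sr Sw : Finset (Fin n)} (A : Finset (Sr → Bool))
    (w : Sr → Bool) : (Sr → Bool) → (Sw → BitTamper) :=
  fun a i => if h : a ∈ A ∧ (i : Fin n) ∈ Sr then
    (if w ⟨i, h.2⟩ then .set1 else .set0) else .keep

lemma bitTamperFun_overwriteVector_of_notMem {Sr Sw : Finset (Fin n)} {A : Finset (Sr → Bool)}
    {w : Sr → Bool} {x : Word n} (hx : readBits Sr x ∉ A) :
    bitTamperFun Sr Sw (overwriteVector A w) x = x := by
  funext i
  have hx' : (fun j : Sr => x j) ∉ A := hx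
  unfold bitTamperFun overwriteVector
  by_cases h : i ∈ Sw
  · simp only [h, hx', dif_pos, false_and, dif_neg, not_false_eq_true, BitTamper.apply]
  · simp only [h, dif_neg, not_false_eq_true]

lemma restrict_bitTamperFun_overwriteVector {Sr Sw : Finset (Fin n)} (hS : Sr ⊆ Sw)
    {A : Finset (Sr → Bool)} {w : Sr → Bool} {x : Word n} (hx : readBits Sr x ∈ A) :
    readBits Sr (bitTamperFun Sr Sw (overwriteVector A w) x) = w := by
  funext i
  have hx' : (fun j : Sr => x j) ∈ A := hx
  unfold readBits
  unfold bitTamperFun overwriteVector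
  simp only [hS i.2, hx', i.2, dif_pos, and_self]
  cases h : w i <;> simp [BitTamper.apply]

/-- For a message `m` that no word with restriction `w` decodes to, overwriting by `w` on the
event `A` destroys `m` exactly on `A`. -/
lemma tamperExp_overwrite_self (C : CodingScheme k n) {Sr Sw : Finset (Fin n)} (hS : Sr ⊆ Sw)
    (A : Finset (Sr → Bool)) {w : Sr → Bool} {m : Word k} (hm : m ∉ consistentMessages C Sr w) :
    (tamperExp C (bitTamperFun Sr Sw (overwriteVector A w)) m (some m)).toReal =
      1 - restrictProb C Sr m A := by
  unfold tamperExp restrictProb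
  rw [map_apply_toReal, ← sum_toReal_eq_one (C.enc m), ← Finset.sum_sub_distrib]
  refine Finset.sum_congr rfl fun x _ => ?_
  by_cases hx : readBits Sr x ∈ A
  · have h2 : C.dec (bitTamperFun Sr Sw (overwriteVector A w) x) ≠ some m := fun h =>
      hm (by
        simp only [consistentMessages, Finset.mem_filter, Finset.mem_univ, true_and]
        exact ⟨_, restrict_bitTamperFun_overwriteVector hS hx, h⟩)
    simp [hx, h2]
  · rw [bitTamperFun_overwriteVector_of_notMem hx]
    by_cases h0 : C.enc m x = 0
    · simp [h0]
    · simp [C.correct m x ((PMF.mem_support_iff _ _).2 h0), hx]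

lemma tamperExp_overwrite_of_ne (C : CodingScheme k n) {Sr Sw : Finset (Fin n)} (hS : Sr ⊆ Sw)
    (A : Finset (Sr → Bool)) {w : Sr → Bool} {m m' : Word k} (hne : m ≠ m')
    (hm' : m' ∉ consistentMessages C Sr w) :
    (tamperExp C (bitTamperFun Sr Sw (overwriteVector A w)) m (some m')).toReal = 0 := by
  unfold tamperExp
  rw [map_apply_toReal]
  refine Finset.sum_eq_zero fun x _ => ?_
  by_cases hx : readBits Sr x ∈ A
  · have h2 : C.dec (bitTamperFun Sr Sw (overwriteVector A w) x) ≠ some m' := fun h =>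
      hm' (by
        simp only [consistentMessages, Finset.mem_filter, Finset.mem_univ, true_and]
        exact ⟨_, restrict_bitTamperFun_overwriteVector hS hx, h⟩)
    simp [h2]
  · rw [bitTamperFun_overwriteVector_of_notMem hx]
    by_cases h0 : C.enc m x = 0
    · simp [h0]
    · simp [C.correct m x ((PMF.mem_support_iff _ _).2 h0), hne]

/-- In a non-malleable scheme the part of the codeword that is read carries almost no information
on the message, among the messages that no word with restriction `w` decodes to. -/
lemma restrictProb_sub_le (C : CodingScheme k n) {ρr ρw ε : ℝ}
    (hC : IsNonMalleable C (tamperFamily n ρr ρw) ε) {Sr Sw : Finset (Fin n)} (hS : Sr ⊆ Sw)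
    (hr : Sr.card = ⌊ρr * n⌋₊) (hw : Sw.card = ⌊ρw * n⌋₊) (A : Finset (Sr → Bool))
    {w : Sr → Bool} {m₀ m₁ : Word k} (hne : m₀ ≠ m₁) (h₀ : m₀ ∉ consistentMessages C Sr w)
    (h₁ : m₁ ∉ consistentMessages C Sr w) :
    restrictProb C Sr m₁ A - restrictProb C Sr m₀ A ≤ 6 * ε := by
  obtain ⟨D, hD⟩ := hC _ ⟨Sr, Sw, overwriteVector A w, hr, hw, rfl⟩
  -- `D m₀` and `D m₁` are small, as `m₁` never decodes to `m₀` and vice versa; hence both survival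
  -- probabilities are close to the weight of `same*` in `D`.
  have e00 := abs_sub_le_two_mul_statDist _ _ (some m₀) |>.trans
    (mul_le_mul_of_nonneg_left (hD m₀) zero_le_two)
  have e10 := abs_sub_le_two_mul_statDist _ _ (some m₀) |>.trans
    (mul_le_mul_of_nonneg_left (hD m₁) zero_le_two)
  have e11 := abs_sub_le_two_mul_statDist _ _ (some m₁) |>.trans
    (mul_le_mul_of_nonneg_left (hD m₁) zero_le_two)
  rw [tamperExp_overwrite_self C hS A h₀, patch_apply_same, abs_le] at e00
  rw [tamperExp_overwrite_self C hS A h₁, patch_apply_same, abs_le] at e11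
  rw [tamperExp_overwrite_of_ne C hS A hne.symm h₀, patch_apply_of_ne _ hne.symm, abs_le] at e10
  have := ENNReal.toReal_nonneg (a := D (some (some m₁)))
  linarith [e00.1, e00.2, e10.1, e10.2, e11.1, e11.2]

lemma restrictProb_eq_one (C : CodingScheme k n) (S : Finset (Fin n)) (m : Word k) :
    restrictProb C S m {a | m ∈ consistentMessages C S a} = 1 := by
  unfold restrictProb
  rw [← sum_toReal_eq_one (C.enc m)]
  refine Finset.sum_congr rfl fun x _ => ?_
  by_cases h0 : C.enc m x = 0
  · simp [h0]
  · rw [if_pos]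
    simp only [consistentMessages, Finset.mem_filter, Finset.mem_univ, true_and]
    exact ⟨x, rfl, C.correct m x ((PMF.mem_support_iff _ _).2 h0)⟩

/-- For a fixed `m₀`, the restriction of an encoding of `m₀` is on average consistent with at most
`2 ^ (n - |S|)` messages. -/
lemma sum_restrictProb_le (C : CodingScheme k n) (S : Finset (Fin n)) (m₀ : Word k)
    (T : Finset (Word k)) :
    ∑ m ∈ T, restrictProb C S m₀ {a | m ∈ consistentMessages C S a} ≤ 2 ^ (n - S.card) := by
  classical
  unfold restrictProb
  rw [Finset.sum_comm, ← mul_one (2 ^ (n - S.card) : ℝ), ← sum_toReal_eq_one (C.enc m₀),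
    Finset.mul_sum]
  refine Finset.sum_le_sum fun x _ => ?_
  rw [← Finset.sum_filter, Finset.sum_const, nsmul_eq_mul]
  refine mul_le_mul_of_nonneg_right ?_ ENNReal.toReal_nonneg
  have : (T.filter fun m => readBits S x ∈
      ({a | m ∈ consistentMessages C S a} : Finset (S → Bool))).card ≤ 2 ^ (n - S.card) := by
    refine (Finset.card_le_card ?_).trans (card_consistentMessages_le C S (readBits S x))
    intro m hm
    simpa using (Finset.mem_filter.1 hm).2
  exact_mod_cast this

/-- A scheme whose message length exceeds the number of unread bits by two is malleable. -/
lemma le_of_isNonMalleable (C : CodingScheme k n) {ρr ρw ε : ℝ} (hrw : ρr ≤ ρw) (hw : ρw ≤ 1)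
    (hC : IsNonMalleable C (tamperFamily n ρr ρw) ε) (hk : n - ⌊ρr * n⌋₊ + 2 ≤ k) :
    1 / 12 ≤ ε := by
  classical
  have hn : (0 : ℝ) ≤ n := Nat.cast_nonneg n
  have hle : ⌊ρr * n⌋₊ ≤ ⌊ρw * n⌋₊ := Nat.floor_le_floor (mul_le_mul_of_nonneg_right hrw hn)
  have hwn : ⌊ρw * n⌋₊ ≤ (Finset.univ : Finset (Fin n)).card := by
    rw [Finset.card_fin]
    exact Nat.floor_le_of_le (mul_le_of_le_one_left hn hw)
  obtain ⟨Sw, -, hSw⟩ := Finset.exists_subset_card_eq hwn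
  obtain ⟨Sr, hS, hSr⟩ := Finset.exists_subset_card_eq (hle.trans hSw.ge)
  rw [← hSr] at hk
  set c := n - Sr.card with hc
  have hcard : 4 * 2 ^ c ≤ 2 ^ k := by
    calc 4 * 2 ^ c = 2 ^ (c + 2) := by ring
      _ ≤ 2 ^ k := Nat.pow_le_pow_right two_pos hk
  have hcpos : 0 < 2 ^ c := by positivity
  set I := consistentMessages C Sr (fun _ => false) with hI
  have hIc : I.card ≤ 2 ^ c := card_consistentMessages_le _ _ _
  have hcompl : 2 ^ k ≤ Iᶜ.card + 2 ^ c := by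
    have := Finset.card_add_card_compl I
    simp only [Fintype.card_pi, Fintype.card_bool, Finset.prod_const, Finset.card_univ,
      Fintype.card_fin] at this
    omega
  obtain ⟨m₀, hm₀⟩ : Iᶜ.Nonempty := Finset.card_pos.1 (by omega)
  -- The probabilities on the left add up to at most `2 ^ c`, and there are at least `3 * 2 ^ c`
  -- messages outside `I`.
  obtain ⟨m₁, hm₁, hle⟩ : ∃ m₁ ∈ Iᶜ,
      restrictProb C Sr m₀ {a | m₁ ∈ consistentMessages C Sr a} ≤ 1 / 2 := by
    by_contra! hcon
    have h1 := Finset.card_nsmul_le_sum _ _ _ fun m hm => (hcon m hm).le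
    rw [nsmul_eq_mul] at h1
    have h2 := h1.trans (sum_restrictProb_le C Sr m₀ Iᶜ)
    have h3 : (3 * 2 ^ c : ℝ) ≤ Iᶜ.card := by
      have : 3 * 2 ^ c ≤ Iᶜ.card := by omega
      exact_mod_cast this
    have h4 : (0 : ℝ) < 2 ^ c := by positivity
    linarith
  have hne : m₀ ≠ m₁ := by
    rintro rfl
    rw [restrictProb_eq_one] at hle
    norm_num at hle
  have := restrictProb_sub_le C hC hS hSr hSw {a | m₁ ∈ consistentMessages C Sr a} hne
    (Finset.mem_compl.1 hm₀) (Finset.mem_compl.1 hm₁)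
  rw [restrictProb_eq_one] at this
  linarith

/-- Distinct messages have distinct codewords. -/
lemma CodingScheme.le (C : CodingScheme k n) : k ≤ n := by
  choose x hx using fun m => (C.enc m).support_nonempty
  have hinj : Function.Injective x := fun m m' h => by
    have h1 := C.correct m _ (hx m)
    rw [h, C.correct m' _ (hx m')] at h1
    exact (Option.some_injective _ h1).symm
  have := Fintype.card_le_of_injective x hinj
  simpa [Nat.pow_le_pow_iff_right] using this

lemma capacity_le {ρr ρw : ℝ} (hrw : ρr ≤ ρw) (hw : ρw ≤ 1) :
    capacity ρr ρw ≤ ENNReal.ofReal (1 - ρr) := by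
  refine iSup_le fun n => iSup_le fun C => iSup_le fun ⟨ε, hε, hC⟩ => ?_
  have hlim : Tendsto (fun k : ℕ => ENNReal.ofReal ((1 - ρr) + 2 / (k : ℝ))) atTop
      (𝓝 (ENNReal.ofReal (1 - ρr))) := by
    refine ENNReal.tendsto_ofReal ?_
    have := (tendsto_const_div_atTop_nhds_zero_nat (2 : ℝ)).const_add (1 - ρr)
    simpa using this
  rw [← hlim.limsup_eq]
  refine limsup_le_limsup ?_
  have hsmall : ∀ᶠ k in atTop, ε k < 1 / 12 := hε.eventually_lt_const (by norm_num)
  filter_upwards [hsmall, eventually_ge_atTop 1] with k hk hk1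
  have hkn := (C k).le
  have hnpos : (0 : ℝ) < n k := by exact_mod_cast (by omega : 0 < n k)
  have hkpos : (0 : ℝ) < k := by exact_mod_cast hk1
  have hlt : k < n k - ⌊ρr * n k⌋₊ + 2 := by
    by_contra! h
    exact absurd (le_of_isNonMalleable (C k) hrw hw (hC k) h) (not_le.2 hk)
  have hfl : ⌊ρr * n k⌋₊ ≤ n k :=
    Nat.floor_le_of_le (mul_le_of_le_one_left hnpos.le (hrw.trans hw))
  have hreal : (k : ℝ) ≤ (1 - ρr) * n k + 2 := by
    have h1 : (k : ℝ) + ⌊ρr * n k⌋₊ ≤ n k + 1 := by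
      exact_mod_cast (by omega : k + ⌊ρr * n k⌋₊ ≤ n k + 1)
    have h2 := Nat.lt_floor_add_one (ρr * n k)
    linarith
  rw [← ENNReal.ofReal_natCast, ← ENNReal.ofReal_natCast, ← ENNReal.ofReal_div_of_pos hnpos]
  refine ENNReal.ofReal_le_ofReal ?_
  rw [div_le_iff₀ hnpos, add_mul]
  have h3 : (2 : ℝ) ≤ 2 / k * n k := by
    rw [div_mul_eq_mul_div, le_div_iff₀ hkpos]
    have : (k : ℝ) ≤ n k := by exact_mod_cast hkn
    linarith
  linarith

end UpperBound

/-! ### Comparison of the two capacities -/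

lemma IsSampledNonMalleable.isNonMalleable {k n q : ℕ} {C : CodingScheme k n}
    {F : Set (Word n → Word n)} {ε : ℝ} (h : IsSampledNonMalleable C F ε q) :
    IsNonMalleable C F ε := by
  obtain ⟨A, -, hA⟩ := h
  exact fun f hf => ⟨_, hA f hf⟩

lemma strictCapacity_le_capacity (ρr ρw : ℝ) : strictCapacity ρr ρw ≤ capacity ρr ρw := by
  refine iSup_le fun n => iSup_le fun C => iSup_le fun ⟨ε, p, hε, hC⟩ => ?_
  have h : IsNMCFamily ρr ρw n C :=
    ⟨ε, by simpa using hε 0, fun k => (hC k).isNonMalleable⟩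
  refine (liminf_le_limsup).trans ?_
  exact le_iSup_of_le n (le_iSup_of_le C (le_iSup_of_le h le_rfl))

/-! ### Random decoders -/

section RandomDecoder

variable {X Y M : Type} [Fintype X] [DecidableEq X] [Fintype Y] [DecidableEq Y]
  [Fintype M]

/-- The distribution of one value of a random decoder: each message has weight `p`, and `none`
has the remaining weight. -/
def symbolWeight (M : Type) [Fintype M] (p : ℝ) : Option M → ℝ
  | none => 1 - Fintype.card M * p
  | some _ => p

/-- The expectation of `G d` for a random decoder `d : Y → Option M` with independent values, each
distributed according to `symbolWeight`, as a finite sum. -/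
def decoderMean (p : ℝ) (G : (Y → Option M) → ℝ) : ℝ :=
  ∑ d, (∏ y, symbolWeight M p (d y)) * G d

/-- The probability that one value of a random decoder satisfies `P`. -/
def symbolProb (p : ℝ) (P : Option M → Prop) [DecidablePred P] : ℝ :=
  ∑ o with P o, symbolWeight M p o

lemma sum_symbolWeight (p : ℝ) : ∑ o, symbolWeight M p o = 1 := by
  simp [Fintype.sum_option, symbolWeight]

lemma symbolProb_eq_some [DecidableEq M] (p : ℝ) (m : M) :
    symbolProb p (fun o => o = some m) = p := by
  simp [symbolProb, Finset.sum_filter, symbolWeight]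

lemma symbolProb_ne_none (p : ℝ) :
    symbolProb (M := M) p (fun o => o ≠ none) = Fintype.card M * p := by
  simp [symbolProb, Finset.sum_filter, Fintype.sum_option, symbolWeight]

lemma symbolWeight_nonneg {p : ℝ} (hp : 0 ≤ p) (hp1 : Fintype.card M * p ≤ 1) (o : Option M) :
    0 ≤ symbolWeight M p o := by
  cases o
  · simpa [symbolWeight] using hp1
  · simpa [symbolWeight] using hp

lemma decoderMean_prod (p : ℝ) (g : Y → Option M → ℝ) :
    decoderMean p (fun d => ∏ y, g y (d y)) = ∏ y, ∑ o, symbolWeight M p o * g y o := by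
  rw [Finset.prod_univ_sum, Fintype.piFinset_univ]
  simp only [decoderMean, Finset.prod_mul_distrib]

lemma decoderMean_one (p : ℝ) : decoderMean (Y := Y) (M := M) p (fun _ => 1) = 1 := by
  have := decoderMean_prod (Y := Y) (M := M) p (fun _ _ => 1)
  simpa only [mul_one, sum_symbolWeight, Finset.prod_const_one] using this

lemma decoderMean_mul_const (p c : ℝ) (G : (Y → Option M) → ℝ) :
    decoderMean p (fun d => G d * c) = decoderMean p G * c := by
  simp only [decoderMean, Finset.sum_mul, mul_assoc]

lemma decoderMean_sum {σ : Type} [Fintype σ] (p : ℝ) (G : σ → (Y → Option M) → ℝ) :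
    decoderMean p (fun d => ∑ j, G j d) = ∑ j, decoderMean p (G j) := by
  simp only [decoderMean, Finset.mul_sum]
  exact Finset.sum_comm

lemma decoderMean_mono {p : ℝ} (hp : 0 ≤ p) (hp1 : Fintype.card M * p ≤ 1)
    {G H : (Y → Option M) → ℝ} (h : ∀ d, G d ≤ H d) : decoderMean p G ≤ decoderMean p H :=
  Finset.sum_le_sum fun d _ => mul_le_mul_of_nonneg_left (h d)
    (Finset.prod_nonneg fun _ _ => symbolWeight_nonneg hp hp1 _)

/-- The union bound in exponential form: if the means of `exp (E j)` add up to less than one, then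
all `E j` are negative for some decoder. -/
lemma exists_forall_neg {σ : Type} [Fintype σ] {p : ℝ} (hp : 0 ≤ p)
    (hp1 : Fintype.card M * p ≤ 1) (E : σ → (Y → Option M) → ℝ)
    (h : ∑ j, decoderMean p (fun d => Real.exp (E j d)) < 1) : ∃ d, ∀ j, E j d < 0 := by
  by_contra! hcon
  refine absurd h (not_lt.2 ?_)
  rw [← decoderMean_sum, ← decoderMean_one (Y := Y) (M := M) p]
  refine decoderMean_mono hp hp1 fun d => ?_
  obtain ⟨j, hj⟩ := hcon d
  exact (Real.one_le_exp hj).trans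
    (Finset.single_le_sum (f := fun j => Real.exp (E j d)) (fun _ _ => (Real.exp_pos _).le)
      (Finset.mem_univ j))

/-- The moment generating function of a weighted count of the places where the decoder satisfies
`P`. -/
lemma decoderMean_exp_le {p : ℝ} (hp : 0 ≤ p) (hp1 : Fintype.card M * p ≤ 1)
    (P : Option M → Prop) [DecidablePred P] (a : Y → ℝ) :
    decoderMean p (fun d => Real.exp (∑ y, if P (d y) then a y else 0)) ≤
      Real.exp (symbolProb p P * ∑ y, (Real.exp (a y) - 1)) := by
  simp only [Real.exp_sum]
  rw [decoderMean_prod p (fun y o => Real.exp (if P o then a y else 0)), Finset.mul_sum,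
    Real.exp_sum]
  refine Finset.prod_le_prod (fun y _ => Finset.sum_nonneg fun o _ =>
    mul_nonneg (symbolWeight_nonneg hp hp1 o) (Real.exp_pos _).le) fun y _ => ?_
  have : ∑ o, symbolWeight M p o * Real.exp (if P o then a y else 0) =
      symbolProb p P * (Real.exp (a y) - 1) + 1 := by
    refine Eq.trans ?_ (congrArg (_ + ·) (sum_symbolWeight (M := M) p))
    rw [symbolProb, Finset.sum_filter, Finset.sum_mul,
      ← Finset.sum_add_distrib]
    refine Finset.sum_congr rfl fun o _ => ?_
    split_ifs
    · ring
    · simp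
  rw [this]
  exact Real.add_one_le_exp _

lemma exp_sub_one_le_two_mul {u : ℝ} (h0 : 0 ≤ u) (h1 : u ≤ 1) : Real.exp u - 1 ≤ 2 * u := by
  have := (abs_le.1 (Real.abs_exp_sub_one_sub_id_le (abs_le.2 ⟨by linarith, h1⟩))).2
  nlinarith

lemma decoderMean_exp_le_of_le_one {p : ℝ} (hp : 0 ≤ p) (hp1 : Fintype.card M * p ≤ 1)
    (P : Option M → Prop) [DecidablePred P] {a : Y → ℝ} (h0 : ∀ y, 0 ≤ a y) (h1 : ∀ y, a y ≤ 1) :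
    decoderMean p (fun d => Real.exp (∑ y, if P (d y) then a y else 0)) ≤
      Real.exp (2 * symbolProb p P * ∑ y, a y) := by
  refine (decoderMean_exp_le hp hp1 P a).trans (Real.exp_le_exp.2 ?_)
  rw [mul_comm 2, mul_assoc, Finset.mul_sum _ _ 2]
  refine mul_le_mul_of_nonneg_left
    (Finset.sum_le_sum fun y _ => exp_sub_one_le_two_mul (h0 y) (h1 y)) ?_
  exact Finset.sum_nonneg fun o _ => symbolWeight_nonneg hp hp1 o

/-- Chernoff bound for the number of codewords of the message `m` in the set `B`. -/
lemma decoderMean_exp_deviation_le [DecidableEq M] {p : ℝ} (hp : 0 ≤ p)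
    (hp1 : Fintype.card M * p ≤ 1) (m : M) (B : Finset Y) {s : ℝ} (hs : |s| ≤ 1) :
    decoderMean p (fun d => Real.exp (s * ∑ y ∈ B, ((if d y = some m then 1 else 0) - p))) ≤
      Real.exp (s ^ 2 * (p * Fintype.card Y)) := by
  have h1 : ∀ d : Y → Option M, Real.exp (s * ∑ y ∈ B, ((if d y = some m then 1 else 0) - p)) =
      Real.exp (∑ y, if d y = some m then (if y ∈ B then s else 0) else 0) *
        Real.exp (-(s * (B.card * p))) := by
    intro d
    rw [← Real.exp_add, Finset.sum_sub_distrib, Finset.sum_const, nsmul_eq_mul, mul_sub,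
      sub_eq_add_neg, Finset.mul_sum, ← Finset.sum_subset (Finset.subset_univ B)]
    · refine congrArg (fun t => Real.exp (t + _)) (Finset.sum_congr rfl fun y hy => ?_)
      simp [hy]
    · intro y _ hy
      simp [hy]
  simp only [h1]
  rw [decoderMean_mul_const]
  refine (mul_le_mul_of_nonneg_right (decoderMean_exp_le hp hp1 (fun o => o = some m) _)
    (Real.exp_pos _).le).trans ?_
  rw [← Real.exp_add, symbolProb_eq_some]
  refine Real.exp_le_exp.2 ?_
  have h2 : ∑ y : Y, (Real.exp (if y ∈ B then s else 0) - 1) = B.card * (Real.exp s - 1) := by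
    have : ∀ y : Y, (Real.exp (if y ∈ B then s else 0) - 1) =
        if y ∈ B then Real.exp s - 1 else 0 := fun y => by split_ifs <;> simp
    simp only [this, Finset.sum_ite_mem, Finset.univ_inter, Finset.sum_const, nsmul_eq_mul]
  rw [h2]
  have h3 := (abs_le.1 (Real.abs_exp_sub_one_sub_id_le hs)).2
  have h4 : (B.card : ℝ) ≤ Fintype.card Y := by exact_mod_cast Finset.card_le_univ B
  have h5 : p * (B.card * (Real.exp s - 1 - s)) ≤ p * (Fintype.card Y * s ^ 2) :=
    mul_le_mul_of_nonneg_left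
      (mul_le_mul h4 h3 (by linarith [Real.add_one_le_exp s]) (Nat.cast_nonneg _)) hp
  nlinarith

/-- Fubini for random decoders: the values inside and outside `A` can be drawn separately. -/
lemma decoderMean_split (p : ℝ) (A : Finset X) (G : (X → Option M) → ℝ) :
    decoderMean p G = decoderMean p (fun v : {x // x ∉ A} → Option M =>
      decoderMean p (fun u : {x // x ∈ A} → Option M =>
        G (fun x => if h : x ∈ A then u ⟨x, h⟩ else v ⟨x, h⟩))) := by
  unfold decoderMean
  rw [← (Equiv.piEquivPiSubtypeProd (fun x => x ∈ A) (fun _ => Option M)).symm.sum_comp,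
    Fintype.sum_prod_type_right]
  refine Finset.sum_congr rfl fun v _ => ?_
  rw [Finset.mul_sum]
  refine Finset.sum_congr rfl fun u _ => ?_
  rw [← mul_assoc]
  congr 1
  rw [← Fintype.prod_subtype_mul_prod_subtype (fun x => x ∈ A), mul_comm]
  congr 1
  · refine Finset.prod_congr (by ext; simp) fun x _ => ?_
    simp [Equiv.piEquivPiSubtypeProd, x.2]
  · refine Finset.prod_congr (by ext; simp) fun x _ => ?_
    simp [Equiv.piEquivPiSubtypeProd, x.2]

/-- The exponential moment of the number of codewords `x ∈ Q ⊆ A` of the message `m` that `f` moves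
to another codeword, outside `A`. As the values of the decoder inside and outside `A` are
independent, it can be computed in two steps. The hypothesis `hs1` says that `f` is not too
concentrated on `Q`. -/
lemma decoderMean_exp_moved_le [DecidableEq M] {p : ℝ} (hp : 0 ≤ p)
    (hp1 : Fintype.card M * p ≤ 1) (m : M) (A : Finset X) (f : X → X) (Q : Finset X)
    (hQA : ∀ x ∈ Q, x ∈ A) (hQf : ∀ x ∈ Q, f x ∉ A) {s : ℝ} (hs : 0 ≤ s) (hs' : s ≤ 1)
    (hs1 : ∀ y, 2 * p * s * (Q.filter fun x => f x = y).card ≤ 1) :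
    decoderMean p (fun d : X → Option M =>
        Real.exp (s * ∑ x ∈ Q, if d x = some m ∧ d (f x) ≠ none then 1 else 0)) ≤
      Real.exp (4 * (Fintype.card M * p) * s * (p * Fintype.card X)) := by
  rw [decoderMean_split p A]
  have key : ∀ v : {x // x ∉ A} → Option M, decoderMean p (fun u : {x // x ∈ A} → Option M =>
      Real.exp (s * ∑ x ∈ Q, if (if h : x ∈ A then u ⟨x, h⟩ else v ⟨x, h⟩) = some m ∧
        (if h : f x ∈ A then u ⟨f x, h⟩ else v ⟨f x, h⟩) ≠ none then 1 else 0)) ≤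
      Real.exp (∑ y, if v y ≠ none then 2 * p * s * (Q.filter fun x => f x = y).card else 0) := by
    intro v
    -- With the values `v` outside `A` given, each `x ∈ Q` has a fixed weight.
    set a : X → ℝ := fun x => if h : f x ∉ A then
      (if x ∈ Q ∧ v ⟨f x, h⟩ ≠ none then s else 0) else 0 with ha
    have ha0 : ∀ x, 0 ≤ a x := fun x => by
      simp only [ha]; split_ifs <;> simp [hs]
    have ha1 : ∀ x, a x ≤ 1 := fun x => by
      simp only [ha]; split_ifs <;> simp [hs']
    have e1 : ∀ u : {x // x ∈ A} → Option M,
        s * ∑ x ∈ Q, (if (if h : x ∈ A then u ⟨x, h⟩ else v ⟨x, h⟩) = some m ∧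
        (if h : f x ∈ A then u ⟨f x, h⟩ else v ⟨f x, h⟩) ≠ none then (1 : ℝ) else 0) =
        ∑ x : {x // x ∈ A}, if u x = some m then a x else 0 := by
      intro u
      have : ∑ x : {x // x ∈ A}, (if u x = some m then a x else 0) =
          ∑ x ∈ A, if h : x ∈ A then (if u ⟨x, h⟩ = some m then a x else 0) else 0 := by
        rw [← Finset.sum_coe_sort A]
        exact Finset.sum_congr rfl fun x _ => by simp [x.2]
      rw [this, ← Finset.sum_subset hQA, Finset.mul_sum]
      · refine Finset.sum_congr rfl fun x hx => ?_
        simp only [ha, hQA x hx, hQf x hx, dif_pos, dif_neg, not_false_eq_true, hx, true_and]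
        by_cases h1 : u ⟨x, hQA x hx⟩ = some m <;> by_cases h2 : v ⟨f x, hQf x hx⟩ = none <;>
          simp [h1, h2]
      · intro x _ hx
        simp [ha, hx]
    simp only [e1]
    refine (decoderMean_exp_le_of_le_one hp hp1 (fun o => o = some m)
      (a := fun x : {x // x ∈ A} => a x) (fun x => ha0 x) (fun x => ha1 x)).trans
      (Real.exp_le_exp.2 (le_of_eq ?_))
    rw [symbolProb_eq_some]
    have e2 : ∑ x : {x // x ∈ A}, a x = ∑ x ∈ Q, a x := by
      rw [Finset.sum_coe_sort A a, ← Finset.sum_subset hQA]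
      intro x _ hx
      simp [ha, hx]
    have e3 : ∀ x ∈ Q, a x = ∑ y : {x // x ∉ A}, if f x = y then (if v y ≠ none then s else 0)
        else 0 := by
      intro x hx
      rw [Finset.sum_eq_single ⟨f x, hQf x hx⟩]
      · simp [ha, hx, hQf x hx]
      · rintro ⟨y, hy⟩ _ hne
        exact if_neg fun h => hne (Subtype.ext h.symm)
      · simp
    rw [e2, Finset.sum_congr rfl e3, Finset.sum_comm, Finset.mul_sum]
    refine Finset.sum_congr rfl fun y _ => ?_
    rw [← Finset.sum_filter, Finset.sum_const, nsmul_eq_mul]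
    split_ifs
    · ring
    · ring
  -- The remaining exponent is a weighted count of the codewords outside `A`.
  refine (decoderMean_mono hp hp1 key).trans ?_
  refine (decoderMean_exp_le_of_le_one hp hp1 (fun o => o ≠ none)
    (a := fun y : {x // x ∉ A} => 2 * p * s * (Q.filter fun x => f x = y).card)
    (fun y => by positivity) (fun y => hs1 y)).trans (Real.exp_le_exp.2 ?_)
  rw [symbolProb_ne_none, ← Finset.mul_sum]
  have h6 : ∑ y : {x // x ∉ A}, ((Q.filter fun x => f x = y).card : ℝ) ≤ Fintype.card X := by
    have : ∑ y : {x // x ∉ A}, (Q.filter fun x => f x = y).card ≤ Fintype.card X := by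
      calc ∑ y : {x // x ∉ A}, (Q.filter fun x => f x = y).card
          = ∑ y ∈ Aᶜ, (Q.filter fun x => f x = y).card :=
            (Finset.sum_subtype Aᶜ (by simp) (fun y => (Q.filter fun x => f x = y).card)).symm
        _ ≤ ∑ y, (Q.filter fun x => f x = y).card :=
            Finset.sum_le_sum_of_subset (Finset.subset_univ _)
        _ = Q.card := (Finset.card_eq_sum_card_fiberwise (by simp)).symm
        _ ≤ Fintype.card X := Finset.card_le_univ Q
    exact_mod_cast this
  calc _ ≤ 2 * (Fintype.card M * p) * (2 * p * s * Fintype.card X) := by gcongr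
    _ = _ := by ring

end RandomDecoder

/-! ### Good decoders exist -/

section GoodDecoder

variable {X M : Type} [Fintype X] [DecidableEq X]

open Classical in
/-- The points with more than `h` preimages under `f`. -/
noncomputable def heavy (f : X → X) (h : ℝ) : Finset X :=
  {y | h < ((Finset.univ.filter fun x => f x = y).card : ℝ)}

/-- The points that `f` moves to a point that is not heavy. -/
noncomputable def lightMoved (f : X → X) (h : ℝ) : Finset X :=
  {x | f x ≠ x ∧ f x ∉ heavy f h}

/-- The coarse description of what `f` does to `x`: `none` if `x` is fixed, `some (some y)` if
it is moved to the heavy point `y`, and `some none` if it is moved to a point that is not heavy. -/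
noncomputable def label (f : X → X) (h : ℝ) (x : X) : Option (Option X) :=
  if f x = x then none else if f x ∈ heavy f h then some (some (f x)) else some none

/-- The possible values of `label f h`. -/
noncomputable def labels (f : X → X) (h : ℝ) : Finset (Option (Option X)) :=
  insert none (insert (some none) ((heavy f h).image fun y => some (some y)))

lemma label_mem_labels (f : X → X) (h : ℝ) (x : X) : label f h x ∈ labels f h := by
  unfold label labels
  split_ifs with h1 h2 <;> simp [*]

lemma card_heavy_le (f : X → X) {r : ℝ} (hr : 0 < r) :
    ((heavy f (Fintype.card X / r)).card : ℝ) ≤ r := by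
  by_contra! hcon
  have h1 : ((heavy f (Fintype.card X / r)).card : ℝ) * (Fintype.card X / r) ≤
      Fintype.card X := by
    rw [← nsmul_eq_mul]
    refine (Finset.card_nsmul_le_sum _ (fun y => ((Finset.univ.filter fun x => f x = y).card : ℝ))
      _ fun y hy => ?_).trans ?_
    · simp only [heavy, Finset.mem_filter, Finset.mem_univ, true_and] at hy
      exact hy.le
    · have : ∑ y ∈ heavy f (Fintype.card X / r), (Finset.univ.filter fun x => f x = y).card ≤
          Fintype.card X := by
        calc _ ≤ ∑ y, (Finset.univ.filter fun x => f x = y).card :=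
              Finset.sum_le_sum_of_subset (Finset.subset_univ _)
          _ = Fintype.card X := (Finset.card_eq_sum_card_fiberwise (by simp)).symm
      exact_mod_cast this
  have hpos : 0 < (heavy f (Fintype.card X / r)).card := by
    exact_mod_cast hr.trans hcon
  obtain ⟨y, -⟩ := Finset.card_pos.1 hpos
  have hX : (0 : ℝ) < Fintype.card X := by
    exact_mod_cast Fintype.card_pos_iff.2 ⟨y⟩
  have h2 : r * (Fintype.card X / r) = Fintype.card X := by field_simp
  have h3 := mul_lt_mul_of_pos_right hcon (div_pos hX hr)
  linarith

lemma card_labels_le (f : X → X) {r : ℝ} (hr : 0 < r) :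
    ((labels f (Fintype.card X / r)).card : ℝ) ≤ r + 2 := by
  have h1 : (labels f (Fintype.card X / r)).card ≤ (heavy f (Fintype.card X / r)).card + 2 := by
    refine (Finset.card_insert_le _ _).trans (Nat.succ_le_succ ?_)
    exact (Finset.card_insert_le _ _).trans (Nat.succ_le_succ Finset.card_image_le)
  have h2 := card_heavy_le f hr
  have h3 : ((labels f (Fintype.card X / r)).card : ℝ) ≤
      (heavy f (Fintype.card X / r)).card + 2 := by exact_mod_cast h1
  linarith

/-- A light point has few preimages in `lightMoved`. -/
lemma card_lightMoved_fiber_le (f : X → X) {h : ℝ} (hh : 0 ≤ h) (y : X) :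
    (((lightMoved f h).filter fun x => f x = y).card : ℝ) ≤ h := by
  by_cases hy : y ∈ heavy f h
  · rw [Finset.filter_eq_empty_iff.2, Finset.card_empty, Nat.cast_zero]
    · exact hh
    · rintro x hx rfl
      simp only [lightMoved, Finset.mem_filter] at hx
      exact hx.2.2 hy
  · simp only [heavy, Finset.mem_filter, Finset.mem_univ, true_and, not_lt] at hy
    refine le_trans ?_ hy
    exact_mod_cast Finset.card_le_card (Finset.filter_subset_filter _ (Finset.subset_univ _))

variable [Fintype M] [DecidableEq M]

/-- The properties of the decoder `d` that make it non-malleable with respect to `f`, where every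
message has about `p |X|` codewords: the distribution of the labels of the codewords of each message
is close to that of the labels of all points, and few points, and few codewords of each message,
are moved by `f` to a codeword that is not a heavy point. -/
structure IsGoodDecoder (d : X → Option M) (f : X → X) (p h ε : ℝ) : Prop where
  deviation : ∀ m, ∀ T ⊆ labels f h,
    |∑ x with label f h x ∈ T, ((if d x = some m then 1 else 0) - p)| ≤
      2 * ε * (p * Fintype.card X)
  moved : ((lightMoved f h).filter fun x => d (f x) ≠ none).card ≤ ε * Fintype.card X
  movedCodewords : ∀ m, ((lightMoved f h).filter fun x => d x = some m ∧ d (f x) ≠ none).card ≤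
    ε * (p * Fintype.card X)

/-- The probability of a deviation by `2 ε p |X|` in the number of codewords of `m` in `B` is at
most `exp (-ε ^ 2 p |X|)`; both signs of `s` are used. -/
lemma decoderMean_exp_deviation_sub_le {p : ℝ} (hp : 0 ≤ p) (hp1 : Fintype.card M * p ≤ 1) (m : M)
    (B : Finset X) {ε s : ℝ} (hs : |s| = ε) (hε : ε ≤ 1) :
    decoderMean p (fun d : X → Option M =>
      Real.exp (s * ∑ y ∈ B, ((if d y = some m then 1 else 0) - p) -
        2 * ε ^ 2 * (p * Fintype.card X))) ≤ Real.exp (-(ε ^ 2 * (p * Fintype.card X))) := by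
  simp only [sub_eq_add_neg, Real.exp_add]
  rw [decoderMean_mul_const]
  simp only [← sub_eq_add_neg]
  refine (mul_le_mul_of_nonneg_right (decoderMean_exp_deviation_le hp hp1 m B (hs.trans_le hε))
    (Real.exp_pos _).le).trans ?_
  rw [← Real.exp_add, ← sq_abs s, hs]
  exact Real.exp_le_exp.2 (by linarith)

omit [DecidableEq M] in
/-- The probability that `f` moves more than `ε |X|` points to codewords that are not heavy. Each
target has at most `|X| / r` preimages, so the weights in the exponent are at most one. -/
lemma decoderMean_exp_moved_sub_le [Nonempty X] {p ε r : ℝ} (hp : 0 ≤ p)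
    (hp1 : Fintype.card M * p ≤ 1) (hr : 0 < r) (hq : Fintype.card M * p ≤ ε / 4) (f : X → X) :
    decoderMean p (fun d : X → Option M => Real.exp ((∑ y, if d y ≠ none then
        r / Fintype.card X * ((lightMoved f (Fintype.card X / r)).filter fun x => f x = y).card
        else 0) - ε * r)) ≤ Real.exp (-(ε * r / 2)) := by
  have hX : (0 : ℝ) < Fintype.card X := by exact_mod_cast Fintype.card_pos
  simp only [sub_eq_add_neg, Real.exp_add]
  rw [decoderMean_mul_const]
  refine (mul_le_mul_of_nonneg_right (decoderMean_exp_le_of_le_one hp hp1 (fun o => o ≠ none)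
    (fun y => by positivity) (fun y => ?_)) (Real.exp_pos _).le).trans ?_
  · refine (mul_le_mul_of_nonneg_left (card_lightMoved_fiber_le f (by positivity) y)
      (by positivity)).trans (le_of_eq ?_)
    field_simp
  · rw [← Real.exp_add, symbolProb_ne_none, ← Finset.mul_sum]
    refine Real.exp_le_exp.2 ?_
    have h1 : ∑ y, (((lightMoved f (Fintype.card X / r)).filter fun x => f x = y).card : ℝ) ≤
        Fintype.card X := by
      have : ∑ y, ((lightMoved f (Fintype.card X / r)).filter fun x => f x = y).card ≤
          Fintype.card X := by
        rw [← Finset.card_eq_sum_card_fiberwise (by simp)]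
        exact Finset.card_le_univ _
      exact_mod_cast this
    have h2 : r / Fintype.card X *
        ∑ y, (((lightMoved f (Fintype.card X / r)).filter fun x => f x = y).card : ℝ) ≤ r := by
      refine (mul_le_mul_of_nonneg_left h1 (by positivity)).trans (le_of_eq ?_)
      field_simp
    have h3 := mul_le_mul hq h2 (by positivity) (le_trans (by positivity) hq)
    linarith

/-- The probability that more than `η p |X|` codewords of `m` in `Q` are moved to codewords. -/
lemma decoderMean_exp_movedCodewords_sub_le [Nonempty X] {p η r : ℝ} (hp : 0 < p)
    (hp1 : Fintype.card M * p ≤ 1) (hr : 0 < r) (hrL : r ≤ 2 * (p * Fintype.card X))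
    (hq : Fintype.card M * p ≤ η / 8) (f : X → X) (m : M) (A Q : Finset X)
    (hQ : Q ⊆ lightMoved f (Fintype.card X / r)) (hQA : ∀ x ∈ Q, x ∈ A) (hQf : ∀ x ∈ Q, f x ∉ A) :
    decoderMean p (fun d : X → Option M => Real.exp (r / (2 * (p * Fintype.card X)) *
        (∑ x ∈ Q, if d x = some m ∧ d (f x) ≠ none then 1 else 0) - η * r / 2)) ≤
      Real.exp (-(η * r / 4)) := by
  have hX : (0 : ℝ) < Fintype.card X := by exact_mod_cast Fintype.card_pos
  simp only [sub_eq_add_neg, Real.exp_add]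
  rw [decoderMean_mul_const]
  refine (mul_le_mul_of_nonneg_right (decoderMean_exp_moved_le hp.le hp1 m A f Q hQA hQf
    (by positivity) ?_ fun y => ?_) (Real.exp_pos _).le).trans ?_
  · rw [div_le_one (by positivity)]
    exact hrL
  · have h1 : ((Q.filter fun x => f x = y).card : ℝ) ≤ Fintype.card X / r := by
      refine le_trans ?_ (card_lightMoved_fiber_le f (by positivity) y)
      exact_mod_cast Finset.card_le_card (Finset.filter_subset_filter _ hQ)
    refine (mul_le_mul_of_nonneg_left h1 (by positivity)).trans (le_of_eq ?_)
    field_simp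
  · rw [← Real.exp_add]
    refine Real.exp_le_exp.2 ?_
    have h2 : 4 * (Fintype.card M * p) * (r / (2 * (p * Fintype.card X))) *
        (p * Fintype.card X) = 2 * (Fintype.card M * p) * r := by
      field_simp
      ring
    rw [h2]
    nlinarith

/-- The probabilistic method: a random decoder is good for all members of a family of functions
simultaneously. The sets `A j` separate points, so that every point moved by `f` leaves one of
them. -/
theorem exists_isGoodDecoder [Nonempty X] {ι J : Type} [Fintype ι] [Fintype J] (f : ι → X → X)
    (A : J → Finset X) (hA : ∀ x y, x ≠ y → ∃ j, x ∈ A j ∧ y ∉ A j) {p ε η r : ℝ} (hp : 0 < p)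
    (hp1 : Fintype.card M * p ≤ 1) (hε : 0 < ε) (hε1 : ε ≤ 1) (hr : 0 < r)
    (hrL : r ≤ 2 * (p * Fintype.card X)) (hq : Fintype.card M * p ≤ ε / 4)
    (hq' : Fintype.card M * p ≤ η / 8) (hη : Fintype.card J * η ≤ ε)
    (hunion : Fintype.card ι * Fintype.card M * (2 * Real.exp (r + 2)) *
        Real.exp (-(ε ^ 2 * (p * Fintype.card X))) + Fintype.card ι * Real.exp (-(ε * r / 2)) +
        Fintype.card ι * Fintype.card M * Fintype.card J * Real.exp (-(η * r / 4)) < 1) :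
    ∃ d : X → Option M, ∀ i, IsGoodDecoder d (f i) p (Fintype.card X / r) ε := by
  have hX : (0 : ℝ) < Fintype.card X := by exact_mod_cast Fintype.card_pos
  set N : ℝ := (Fintype.card X : ℝ) with hN
  set Q : ι → J → Finset X := fun i j =>
    (lightMoved (f i) (N / r)).filter fun x => x ∈ A j ∧ f i x ∉ A j with hQ
  -- The exponents of the bad events: deviations (in both directions) for each set of labels, moved
  -- points, and moved codewords of each message that leave `A j`.
  let S : Type := (Σ i : ι, (M × Bool) × {T // T ∈ (labels (f i) (N / r)).powerset}) ⊕
    (ι ⊕ (ι × M × J))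
  let E : S → (X → Option M) → ℝ := Sum.elim
    (fun t d => (if t.2.1.2 then ε else -ε) * (∑ x with label (f t.1) (N / r) x ∈ t.2.2.1,
      ((if d x = some t.2.1.1 then 1 else 0) - p)) - 2 * ε ^ 2 * (p * N))
    (Sum.elim (fun i d => (∑ y, if d y ≠ none then
        r / N * ((lightMoved (f i) (N / r)).filter fun x => f i x = y).card else 0) - ε * r)
      (fun t d => r / (2 * (p * N)) *
        (∑ x ∈ Q t.1 t.2.2, if d x = some t.2.1 ∧ d (f t.1 x) ≠ none then 1 else 0) - η * r / 2))
  obtain ⟨d, hd⟩ : ∃ d, ∀ j, E j d < 0 := by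
    refine exists_forall_neg hp.le hp1 E (lt_of_le_of_lt ?_ hunion)
    rw [Fintype.sum_sum_type, Fintype.sum_sum_type, add_assoc]
    refine add_le_add ?_ (add_le_add ?_ ?_)
    · rw [Fintype.sum_sigma, mul_assoc (Fintype.card ι : ℝ), mul_assoc (Fintype.card ι : ℝ),
        ← nsmul_eq_mul, ← Finset.card_univ]
      refine Finset.sum_le_card_nsmul _ _ _ fun i _ => ?_
      refine (Finset.sum_le_card_nsmul _ _ (Real.exp (-(ε ^ 2 * (p * N)))) fun t _ => ?_).trans ?_
      · refine decoderMean_exp_deviation_sub_le hp.le hp1 t.1.1 _ ?_ hε1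
        split_ifs <;> simp [abs_of_pos hε]
      · rw [nsmul_eq_mul]
        refine mul_le_mul_of_nonneg_right ?_ (Real.exp_pos _).le
        rw [Finset.card_univ, Fintype.card_prod, Fintype.card_prod, Fintype.card_bool,
          Fintype.card_coe, Finset.card_powerset]
        push_cast
        rw [mul_assoc]
        have h2 : (2 : ℝ) ^ (labels (f i) (N / r)).card ≤ Real.exp (r + 2) := by
          calc (2 : ℝ) ^ (labels (f i) (N / r)).card
              ≤ Real.exp 1 ^ (labels (f i) (N / r)).card := by
                gcongr
                linarith [Real.add_one_le_exp 1]
            _ = Real.exp ((labels (f i) (N / r)).card) := by rw [← Real.exp_nat_mul, mul_one]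
            _ ≤ _ := Real.exp_le_exp.2 (card_labels_le (f i) hr)
        gcongr
    · rw [← nsmul_eq_mul, ← Finset.card_univ]
      exact Finset.sum_le_card_nsmul _ _ _ fun i _ =>
        decoderMean_exp_moved_sub_le hp.le hp1 hr hq (f i)
    · have hc : (Fintype.card ι * Fintype.card M * Fintype.card J : ℝ) =
          ((Finset.univ : Finset (ι × M × J)).card : ℝ) := by
        rw [Finset.card_univ, Fintype.card_prod, Fintype.card_prod]
        push_cast
        ring
      rw [hc, ← nsmul_eq_mul]
      refine Finset.sum_le_card_nsmul _ _ _ fun t _ =>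
        decoderMean_exp_movedCodewords_sub_le hp hp1 hr hrL hq' (f t.1) t.2.1 (A t.2.2)
          (Q t.1 t.2.2) (Finset.filter_subset _ _) (fun x hx => ?_) fun x hx => ?_
      · exact (Finset.mem_filter.1 hx).2.1
      · exact (Finset.mem_filter.1 hx).2.2
  refine ⟨d, fun i => ⟨fun m T hT => ?_, ?_, fun m => ?_⟩⟩
  · have h1 := hd (Sum.inl ⟨i, (m, true), ⟨T, Finset.mem_powerset.2 hT⟩⟩)
    have h2 := hd (Sum.inl ⟨i, (m, false), ⟨T, Finset.mem_powerset.2 hT⟩⟩)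
    simp only [E, Sum.elim_inl, if_true, Bool.false_eq_true, if_false] at h1 h2
    rw [abs_le]
    constructor
    · refine le_of_mul_le_mul_left ?_ hε
      linarith
    · refine le_of_mul_le_mul_left ?_ hε
      linarith
  · have h1 := hd (Sum.inr (Sum.inl i))
    simp only [E, Sum.elim_inl, Sum.elim_inr] at h1
    have h2 : ((((lightMoved (f i) (N / r)).filter fun x => d (f i x) ≠ none).card : ℕ) : ℝ) =
        ∑ y, if d y ≠ none then
          (((lightMoved (f i) (N / r)).filter fun x => f i x = y).card : ℝ) else 0 := by
      rw [Finset.card_eq_sum_card_fiberwise (f := f i) (t := Finset.univ) (by simp)]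
      push_cast
      refine Finset.sum_congr rfl fun y _ => ?_
      rw [Finset.filter_filter]
      split_ifs with hy
      · congr 2
        refine Finset.filter_congr fun x _ => ?_
        constructor
        · exact fun h => h.2
        · exact fun h => ⟨h ▸ hy, h⟩
      · rw [Finset.filter_eq_empty_iff.2, Finset.card_empty, Nat.cast_zero]
        rintro x - ⟨h, rfl⟩
        exact hy h
    have h3 : ∀ y, (if d y ≠ none then
        r / N * (((lightMoved (f i) (N / r)).filter fun x => f i x = y).card : ℝ) else 0) =
        r / N * (if d y ≠ none then
          (((lightMoved (f i) (N / r)).filter fun x => f i x = y).card : ℝ) else 0) :=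
      fun y => by split_ifs <;> simp
    simp only [h3] at h1
    rw [← Finset.mul_sum, ← h2] at h1
    refine le_of_mul_le_mul_left ?_ (div_pos hr hX)
    have : r / N * (ε * N) = ε * r := by field_simp
    linarith
  · have hcover : ((lightMoved (f i) (N / r)).filter fun x => d x = some m ∧ d (f i x) ≠ none) ⊆
        Finset.univ.biUnion fun j =>
          (Q i j).filter fun x => d x = some m ∧ d (f i x) ≠ none := by
      intro x hx
      rw [Finset.mem_filter] at hx
      obtain ⟨j, hj⟩ := hA x (f i x) (Ne.symm (Finset.mem_filter.1 hx.1).2.1)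
      simp only [Finset.mem_biUnion, Finset.mem_univ, true_and, hQ, Finset.mem_filter]
      exact ⟨j, ⟨hx.1, hj⟩, hx.2⟩
    have h1 : ∀ j, (((Q i j).filter fun x => d x = some m ∧ d (f i x) ≠ none).card : ℝ) ≤
        η * (p * N) := by
      intro j
      have h2 := hd (Sum.inr (Sum.inr (i, m, j)))
      simp only [E, Sum.elim_inr] at h2
      rw [← Finset.natCast_card_filter] at h2
      refine le_of_mul_le_mul_left ?_ (div_pos hr (by positivity : 0 < 2 * (p * N)))
      have : r / (2 * (p * N)) * (η * (p * N)) = η * r / 2 := by field_simp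
      linarith
    have h3 := (Finset.card_le_card hcover).trans Finset.card_biUnion_le
    have h4 : (((lightMoved (f i) (N / r)).filter
        fun x => d x = some m ∧ d (f i x) ≠ none).card : ℝ) ≤
        ∑ j, (((Q i j).filter fun x => d x = some m ∧ d (f i x) ≠ none).card : ℝ) := by
      exact_mod_cast h3
    refine h4.trans ((Finset.sum_le_card_nsmul _ _ _ fun j _ => h1 j).trans ?_)
    rw [nsmul_eq_mul, Finset.card_univ, ← mul_assoc]
    exact mul_le_mul_of_nonneg_right hη (by positivity)

/-! ### Good decoders are non-malleable -/

/-- The total variation of a signed measure does not increase under a further map. -/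
lemma sum_abs_sum_comp_le {α β γ : Type} [Fintype α] [Fintype γ] [DecidableEq β] [DecidableEq γ]
    (a : α → ℝ) (l : α → β) (B : Finset β) (hl : ∀ x, l x ∈ B) (g : β → γ) :
    ∑ o, |∑ x with g (l x) = o, a x| ≤ ∑ b ∈ B, |∑ x with l x = b, a x| := by
  calc ∑ o, |∑ x with g (l x) = o, a x|
      ≤ ∑ o, ∑ b ∈ B with g b = o, |∑ x with l x = b, a x| := by
        refine Finset.sum_le_sum fun o _ => ?_
        refine le_trans (le_of_eq ?_) (Finset.abs_sum_le_sum_abs _ _)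
        rw [← Finset.sum_fiberwise_of_maps_to (t := B.filter fun b => g b = o) (g := l)]
        · refine congrArg _ (Finset.sum_congr rfl fun b hb => ?_)
          rw [Finset.filter_filter]
          refine Finset.sum_congr (Finset.filter_congr fun x _ => ?_) fun _ _ => rfl
          constructor
          · exact fun h => h.2
          · exact fun h => ⟨h ▸ (Finset.mem_filter.1 hb).2, h⟩
        · intro x hx
          simp only [Finset.mem_filter, Finset.mem_univ, true_and] at hx ⊢
          exact ⟨hl x, hx⟩
    _ = ∑ b ∈ B, |∑ x with l x = b, a x| :=
        Finset.sum_fiberwise_of_maps_to (fun _ _ => Finset.mem_univ _) _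

/-- Replacing the map `g` by `g'` changes the pushforward only by the mass where they differ. -/
lemma sum_abs_sum_le_add {α γ : Type} [Fintype α] [Fintype γ] [DecidableEq γ]
    (a : α → ℝ) (g g' : α → γ) :
    ∑ o, |∑ x with g x = o, a x| ≤
      ∑ o, |∑ x with g' x = o, a x| + 2 * ∑ x with g x ≠ g' x, |a x| := by
  have h : ∀ o, |∑ x with g x = o, a x| ≤ |∑ x with g' x = o, a x| +
      (∑ x with g x = o, (if g x ≠ g' x then |a x| else 0) +
        ∑ x with g' x = o, (if g x ≠ g' x then |a x| else 0)) := by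
    intro o
    rw [← sub_le_iff_le_add']
    refine (abs_sub_abs_le_abs_sub _ _).trans ?_
    simp only [Finset.sum_filter]
    rw [← Finset.sum_sub_distrib, ← Finset.sum_add_distrib]
    refine (Finset.abs_sum_le_sum_abs _ _).trans (Finset.sum_le_sum fun x _ => ?_)
    by_cases h1 : g x = o <;> by_cases h2 : g' x = o
    · simp [h1, h2]
    · simp [h1, h2, Ne.symm h2]
    · simp [h1, h2]
    · simp [h1, h2]
  refine (Finset.sum_le_sum fun o _ => h o).trans (le_of_eq ?_)
  rw [Finset.sum_add_distrib, Finset.sum_add_distrib,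
    Finset.sum_fiberwise, Finset.sum_fiberwise, Finset.sum_filter]
  ring

/-- The positive and the negative parts are attained on subsets of `B`. -/
lemma sum_abs_le_of_forall_subset {β : Type} [DecidableEq β] (B : Finset β) (b : β → ℝ) {c : ℝ}
    (h : ∀ T ⊆ B, |∑ l ∈ T, b l| ≤ c) : ∑ l ∈ B, |b l| ≤ 2 * c := by
  rw [← Finset.sum_filter_add_sum_filter_not B (fun l => 0 ≤ b l)]
  have h1 := (abs_le.1 (h _ (Finset.filter_subset (fun l => 0 ≤ b l) B))).2
  have h2 := (abs_le.1 (h _ (Finset.filter_subset (fun l => ¬ 0 ≤ b l) B))).1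
  have h3 : ∑ l ∈ B with 0 ≤ b l, |b l| = ∑ l ∈ B with 0 ≤ b l, b l :=
    Finset.sum_congr rfl fun l hl => abs_of_nonneg (Finset.mem_filter.1 hl).2
  have h4 : ∑ l ∈ B with ¬ 0 ≤ b l, |b l| = -∑ l ∈ B with ¬ 0 ≤ b l, b l := by
    rw [← Finset.sum_neg_distrib]
    exact Finset.sum_congr rfl fun l hl => abs_of_neg (not_le.1 (Finset.mem_filter.1 hl).2)
  linarith

namespace IsGoodDecoder

variable {d : X → Option M} {f : X → X} {p h ε : ℝ}

omit [Fintype M] in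
lemma abs_card_sub_le (hd : IsGoodDecoder d f p h ε) (m : M) :
    |((Finset.univ.filter fun x => d x = some m).card : ℝ) - p * Fintype.card X| ≤
      2 * ε * (p * Fintype.card X) := by
  have := hd.deviation m (labels f h) subset_rfl
  simp only [label_mem_labels, Finset.filter_true, Finset.sum_sub_distrib, Finset.sum_const,
    nsmul_eq_mul, Finset.card_univ] at this
  rwa [← Finset.natCast_card_filter, mul_comm (Fintype.card X : ℝ)] at this

/-- The statistical distance, up to the factor two, of the outcomes for a random codeword of `m` and
for a random point. -/
lemma sum_abs_le [Nonempty X] (hd : IsGoodDecoder d f p h ε) (hp : 0 < p)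
    (hε4 : ε ≤ 1 / 4) (m : M) :
    ∑ o, |∑ x with (if f x = x then some m else d (f x)) = o,
      ((if d x = some m then (1 : ℝ) else 0) / (Finset.univ.filter fun x => d x = some m).card -
        1 / Fintype.card X)| ≤ 18 * ε := by
  have hN : (0 : ℝ) < Fintype.card X := by exact_mod_cast Fintype.card_pos
  have hZL := abs_le.1 (hd.abs_card_sub_le m)
  have hmoved := hd.moved
  have hmc := hd.movedCodewords m
  have hdev := hd.deviation m
  set N : ℝ := (Fintype.card X : ℝ)
  set Z : ℝ := ((Finset.univ.filter fun x => d x = some m).card : ℝ) with hZ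
  have hL : 0 < p * N := mul_pos hp hN
  have hZ2 : p * N ≤ 2 * Z := by nlinarith
  have hZ0 : 0 < Z := by linarith
  set a : X → ℝ := fun x => (if d x = some m then (1 : ℝ) else 0) / Z - 1 / N with ha
  have hε0 : 0 ≤ ε := by
    by_contra! hneg
    nlinarith [hZL.1, hZL.2]
  have hlabel : ∑ b ∈ labels f h, |∑ x with label f h x = b, a x| ≤ 12 * ε := by
    have e1 : ∀ B : Finset X, ∑ x ∈ B, a x =
        (∑ x ∈ B, ((if d x = some m then 1 else 0) - p)) / Z + B.card * ((p * N - Z) / (N * Z)) := by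
      intro B
      rw [Finset.sum_div, ← nsmul_eq_mul, ← Finset.sum_const, ← Finset.sum_add_distrib]
      refine Finset.sum_congr rfl fun x _ => ?_
      simp only [ha]
      field_simp
      ring
    have e2 : ∑ b ∈ labels f h, |∑ x with label f h x = b,
        ((if d x = some m then 1 else 0) - p)| ≤ 2 * (2 * ε * (p * N)) := by
      refine sum_abs_le_of_forall_subset _ _ fun T hT => ?_
      refine le_trans (le_of_eq ?_) (hdev T hT)
      rw [← Finset.sum_fiberwise_of_maps_to (t := T) (g := label f h)]
      · refine congrArg _ (Finset.sum_congr rfl fun b hb => ?_)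
        rw [Finset.filter_filter]
        refine Finset.sum_congr (Finset.filter_congr fun x _ => ?_) fun _ _ => rfl
        constructor
        · rintro rfl
          exact ⟨hb, rfl⟩
        · exact fun h => h.2
      · exact fun x hx => (Finset.mem_filter.1 hx).2
    have e3 : ∑ b ∈ labels f h, ((Finset.univ.filter fun x => label f h x = b).card : ℝ) = N := by
      have : ∑ b ∈ labels f h, (Finset.univ.filter fun x => label f h x = b).card =
          Fintype.card X := by
        rw [← Finset.card_univ]
        exact (Finset.card_eq_sum_card_fiberwise fun x _ => label_mem_labels f h x).symm
      rw [← Nat.cast_sum, this]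
    calc ∑ b ∈ labels f h, |∑ x with label f h x = b, a x|
        ≤ ∑ b ∈ labels f h, (|∑ x with label f h x = b, ((if d x = some m then 1 else 0) - p)| / Z +
            (Finset.univ.filter fun x => label f h x = b).card * (|p * N - Z| / (N * Z))) := by
          refine Finset.sum_le_sum fun b _ => ?_
          rw [e1]
          refine (abs_add_le _ _).trans (le_of_eq ?_)
          rw [abs_div, abs_mul, abs_div, abs_of_pos hZ0, abs_of_pos (mul_pos hN hZ0), Nat.abs_cast]
      _ = (∑ b ∈ labels f h, |∑ x with label f h x = b, ((if d x = some m then 1 else 0) - p)|) / Z +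
            N * (|p * N - Z| / (N * Z)) := by
          rw [Finset.sum_add_distrib, ← Finset.sum_div, ← Finset.sum_mul, e3]
      _ ≤ 2 * (2 * ε * (p * N)) / Z + N * (2 * ε * (p * N) / (N * Z)) := by
          have : |p * N - Z| ≤ 2 * ε * (p * N) := abs_le.2 ⟨by linarith, by linarith⟩
          gcongr
      _ = 6 * ε * (p * N / Z) := by
          field_simp
          ring
      _ ≤ 6 * ε * 2 := by
          refine mul_le_mul_of_nonneg_left ?_ (by positivity)
          rw [div_le_iff₀ hZ0]
          exact hZ2
      _ = 12 * ε := by ring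
  -- The outcome that replaces every light target by `none`; it depends on the label alone.
  set g' : X → Option M := fun x => (label f h x).elim (some m) (fun z => z.elim none d) with hg'
  have hne : (Finset.univ.filter fun x => (if f x = x then some m else d (f x)) ≠ g' x) ⊆
      (lightMoved f h).filter fun x => d (f x) ≠ none := by
    intro x hx
    simp only [Finset.mem_filter, Finset.mem_univ, true_and, hg', label, lightMoved] at hx ⊢
    split_ifs at hx with h1 h2
    · simp at hx
    · simp at hx
    · exact ⟨⟨h1, h2⟩, hx⟩
  have hdiff : ∑ x with (if f x = x then some m else d (f x)) ≠ g' x, |a x| ≤ 3 * ε := by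
    calc _ ≤ ∑ x ∈ (lightMoved f h).filter fun x => d (f x) ≠ none, |a x| :=
          Finset.sum_le_sum_of_subset_of_nonneg hne fun _ _ _ => abs_nonneg _
      _ ≤ ∑ x ∈ (lightMoved f h).filter fun x => d (f x) ≠ none,
            ((if d x = some m then (1 : ℝ) else 0) / Z + 1 / N) := by
          refine Finset.sum_le_sum fun x _ => ?_
          refine (abs_sub _ _).trans (le_of_eq ?_)
          rw [abs_of_nonneg, abs_of_nonneg] <;> positivity
      _ = ((lightMoved f h).filter fun x => d x = some m ∧ d (f x) ≠ none).card / Z +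
            ((lightMoved f h).filter fun x => d (f x) ≠ none).card * (1 / N) := by
          rw [Finset.sum_add_distrib, ← Finset.sum_div, ← Finset.natCast_card_filter,
            Finset.filter_filter, Finset.sum_const, nsmul_eq_mul]
          simp only [and_comm]
      _ ≤ ε * (p * N) / Z + ε * N * (1 / N) := by gcongr
      _ = ε * (p * N / Z) + ε := by field_simp
      _ ≤ ε * 2 + ε := by
          have : p * N / Z ≤ 2 := by
            rw [div_le_iff₀ hZ0]
            exact hZ2
          gcongr
      _ = 3 * ε := by ring
  have h1 := sum_abs_sum_le_add a (fun x => if f x = x then some m else d (f x)) g'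
  have h2 := sum_abs_sum_comp_le a (label f h) (labels f h) (label_mem_labels f h)
    (fun b => b.elim (some m) (fun z => z.elim none d))
  simp only [hg'] at h1 hdiff
  linarith

end IsGoodDecoder

end GoodDecoder

/-! ### The coding scheme and the sampler of a decoder -/

section DecoderScheme

variable {k n : ℕ}

/-- The words that `d` decodes to `m`. -/
def codewords (d : Word n → Option (Word k)) (m : Word k) : Finset (Word n) :=
  Finset.univ.filter fun x => d x = some m

lemma codewords_nonempty {d : Word n → Option (Word k)} (hd : ∀ m, ∃ x, d x = some m)
    (m : Word k) : (codewords d m).Nonempty := by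
  obtain ⟨x, hx⟩ := hd m
  exact ⟨x, Finset.mem_filter.2 ⟨Finset.mem_univ x, hx⟩⟩

/-- The coding scheme with decoder `d` that encodes a message by a uniformly random codeword. -/
noncomputable def decoderScheme (d : Word n → Option (Word k)) (hd : ∀ m, ∃ x, d x = some m) :
    CodingScheme k n where
  enc m := PMF.uniformOfFinset (codewords d m) (codewords_nonempty hd m)
  dec := d
  correct m x hx := by
    rw [PMF.mem_support_uniformOfFinset_iff] at hx
    exact (Finset.mem_filter.1 hx).2

/-- The algorithm that queries the oracle at a random point and outputs `same*` if it is a fixed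
point and the decoded answer otherwise. -/
noncomputable def oneQuerySampler (d : Word n → Option (Word k)) :
    PMF (OracleAlg (Word n) (SimOutcome k)) :=
  (PMF.uniformOfFintype (Word n)).map fun x =>
    .query x fun y => .output (if y = x then none else some (d y))

lemma queriesAtMost_oneQuerySampler (d : Word n → Option (Word k)) :
    ∀ a ∈ (oneQuerySampler d).support, a.QueriesAtMost 1 := by
  intro a ha
  rw [oneQuerySampler, PMF.mem_support_map_iff] at ha
  obtain ⟨x, -, rfl⟩ := ha
  exact fun _ => trivial

/-- Both experiments apply one and the same map, to a random codeword of `m` and to a random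
word. -/
lemma statDist_oneQuerySampler (d : Word n → Option (Word k)) (hd : ∀ m, ∃ x, d x = some m)
    (f : Word n → Word n) (m : Word k) :
    statDist (tamperExp (decoderScheme d hd) f m)
      (patch ((oneQuerySampler d).map fun a => a.run f) m) =
    1 / 2 * ∑ o, |∑ x with (if f x = x then some m else d (f x)) = o,
      ((if d x = some m then (1 : ℝ) else 0) / (Finset.univ.filter fun x => d x = some m).card -
        1 / Fintype.card (Word n))| := by
  unfold statDist
  congr 1
  refine Finset.sum_congr rfl fun o _ => congrArg _ ?_
  rw [tamperExp, patch, oneQuerySampler, PMF.map_comp, PMF.map_comp, map_apply_toReal,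
    map_apply_toReal, ← Finset.sum_sub_distrib, Finset.sum_filter]
  refine Finset.sum_congr rfl fun x _ => ?_
  have h1 : (((fun o : SimOutcome k => o.getD (some m)) ∘ fun a => OracleAlg.run f a) ∘ fun x =>
      OracleAlg.query x fun y => .output (if y = x then none else some (d y))) x =
      if f x = x then some m else d (f x) := by
    simp only [Function.comp_apply, OracleAlg.run]
    split_ifs <;> rfl
  have h2 : ((decoderScheme d hd).enc m x).toReal =
      (if d x = some m then (1 : ℝ) else 0) / (Finset.univ.filter fun x => d x = some m).card := by
    have hmem : x ∈ codewords d m ↔ d x = some m := by simp [codewords]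
    change (PMF.uniformOfFinset (codewords d m) (codewords_nonempty hd m) x).toReal = _
    rw [PMF.uniformOfFinset_apply]
    by_cases h : d x = some m
    · rw [if_pos (hmem.2 h), if_pos h, ENNReal.toReal_inv, ENNReal.toReal_natCast, one_div]
      rfl
    · rw [if_neg (fun hx => h (hmem.1 hx)), if_neg h, ENNReal.toReal_zero, zero_div]
  have h3 : (PMF.uniformOfFintype (Word n) x).toReal = 1 / Fintype.card (Word n) := by
    simp [PMF.uniformOfFintype_apply]
  rw [h1, h2, h3]
  -- A codeword of `m` that `f` fixes decodes to `m`, so patching does not change the outcome.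
  have h4 : d x = some m → (decoderScheme d hd).dec (f x) =
      if f x = x then some m else d (f x) := fun h => by
    split_ifs with h'
    · rw [h']; exact h
    · rfl
  by_cases h : d x = some m
  · rw [h4 h]
    split_ifs <;> simp
  · simp only [h, if_false, zero_div, ite_self]
    split_ifs <;> simp

end DecoderScheme

/-! ### Counting bit tampering functions -/

instance : Fintype BitTamper where
  elems := ⟨([.set0, .set1, .keep, .flip] : List BitTamper), by simp⟩
  complete := by rintro ⟨⟩ <;> simp

lemma card_bitTamper : Fintype.card BitTamper = 4 := rfl

/-- The data `(Sr, Sw, g)` with `|Sr| = t` that define a bit tampering function. -/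
abbrev TamperIndex (n t : ℕ) : Type :=
  Σ S : {S : Finset (Fin n) // S.card = t} × Finset (Fin n), (S.1.1 → Bool) → (S.2 → BitTamper)

lemma card_tamperIndex_le (n t : ℕ) :
    Fintype.card (TamperIndex n t) ≤ 2 ^ (2 * n + 2 * n * 2 ^ t) := by
  rw [Fintype.card_sigma]
  refine (Finset.sum_le_card_nsmul _ _ ((4 ^ n) ^ 2 ^ t) fun S _ => ?_).trans ?_
  · rw [Fintype.card_fun, Fintype.card_fun, Fintype.card_fun, Fintype.card_bool, card_bitTamper,
      Fintype.card_coe, Fintype.card_coe, S.1.2]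
    gcongr
    · norm_num
    · simpa using Finset.card_le_univ S.2
  · rw [smul_eq_mul, Finset.card_univ, Fintype.card_prod]
    have h1 : Fintype.card {S : Finset (Fin n) // S.card = t} ≤ 2 ^ n := by
      refine (Fintype.card_subtype_le _).trans ?_
      simp
    have h2 : Fintype.card (Finset (Fin n)) = 2 ^ n := by simp
    calc _ ≤ 2 ^ n * 2 ^ n * (4 ^ n) ^ 2 ^ t := by rw [h2]; gcongr
      _ = 2 ^ (2 * n + 2 * n * 2 ^ t) := by
        rw [show 4 = 2 ^ 2 from rfl, ← pow_mul, ← pow_mul, ← pow_add, ← pow_add]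
        congr 1
        ring

/-- The union bound over all tampering functions, messages and coordinate half cubes. -/
lemma card_tamperIndex_mul_lt {n t k : ℕ} (hn : 1 ≤ n) (hkn : k ≤ n) :
    (3 : ℝ) * (Fintype.card (TamperIndex n t) * 2 ^ k * (2 * n)) <
      Real.exp (9 * n * 2 ^ t) := by
  have hT : 1 ≤ 2 ^ t := Nat.one_le_two_pow
  have hnT : n ≤ n * 2 ^ t := Nat.le_mul_of_pos_right n (by positivity)
  have h1 : 3 * (Fintype.card (TamperIndex n t) * 2 ^ k * (2 * n)) ≤ 2 ^ (8 * (n * 2 ^ t)) := by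
    have h3 : 3 ≤ 2 ^ (2 * (n * 2 ^ t)) := by
      calc 3 ≤ 2 ^ (2 * 1) := by norm_num
        _ ≤ _ := Nat.pow_le_pow_right two_pos (by omega)
    have h4 : Fintype.card (TamperIndex n t) ≤ 2 ^ (4 * (n * 2 ^ t)) := by
      refine (card_tamperIndex_le n t).trans (Nat.pow_le_pow_right two_pos ?_)
      rw [mul_assoc 2 n]
      omega
    have h5 : 2 ^ k ≤ 2 ^ (n * 2 ^ t) := Nat.pow_le_pow_right two_pos (hkn.trans hnT)
    have h6 : 2 * n ≤ 2 ^ (n * 2 ^ t) := by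
      obtain ⟨j, rfl⟩ : ∃ j, n = j + 1 := ⟨n - 1, by omega⟩
      refine le_trans ?_ (Nat.pow_le_pow_right two_pos hnT)
      have := Nat.lt_two_pow_self (n := j)
      rw [pow_succ]
      omega
    calc _ ≤ 2 ^ (2 * (n * 2 ^ t)) * (2 ^ (4 * (n * 2 ^ t)) * 2 ^ (n * 2 ^ t) *
          2 ^ (n * 2 ^ t)) := by gcongr
      _ = _ := by
        rw [← pow_add, ← pow_add, ← pow_add]
        congr 1
        ring
  have h2 : (3 : ℝ) * (Fintype.card (TamperIndex n t) * 2 ^ k * (2 * n)) ≤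
      2 ^ (8 * (n * 2 ^ t)) := by exact_mod_cast h1
  refine h2.trans_lt ?_
  calc (2 : ℝ) ^ (8 * (n * 2 ^ t)) ≤ Real.exp 1 ^ (8 * (n * 2 ^ t)) := by
        gcongr
        linarith [Real.add_one_le_exp 1]
    _ = Real.exp ((8 * (n * 2 ^ t) : ℕ)) := by rw [← Real.exp_nat_mul, mul_one]
    _ < _ := by
        refine Real.exp_lt_exp.2 ?_
        push_cast
        have : (0 : ℝ) < n * 2 ^ t := by positivity
        linarith

lemma union_bound_lt_one {c K n ε Λ r : ℝ} (hc : 0 ≤ c) (hK : 1 ≤ K) (hn : 1 ≤ n) (hΛ : 9 ≤ Λ)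
    (hrε : r * ε = 8 * n * Λ) (hr : 32 * Λ ≤ r) (hcard : 3 * (c * K * (2 * n)) < Real.exp Λ) :
    c * K * (2 * Real.exp (r + 2)) * Real.exp (-(2 * r)) + c * Real.exp (-(ε * r / 2)) +
      c * K * (2 * n) * Real.exp (-(ε / (2 * n) * r / 4)) < 1 := by
  have e1 : 2 * Real.exp (r + 2) * Real.exp (-(2 * r)) ≤ 2 * n * Real.exp (-Λ) := by
    rw [mul_assoc, ← Real.exp_add]
    have : Real.exp (r + 2 + -(2 * r)) ≤ Real.exp (-Λ) := Real.exp_le_exp.2 (by linarith)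
    exact mul_le_mul (by linarith) this (Real.exp_pos _).le (by linarith)
  have e2 : Real.exp (-(ε * r / 2)) ≤ Real.exp (-Λ) := by
    refine Real.exp_le_exp.2 ?_
    rw [mul_comm ε, hrε]
    nlinarith
  have e3 : Real.exp (-(ε / (2 * n) * r / 4)) = Real.exp (-Λ) := by
    have : ε / (2 * n) * r / 4 = r * ε / (8 * n) := by
      field_simp
      ring
    rw [this, hrε, mul_div_cancel_left₀ _ (by positivity)]
  have e4 : 1 ≤ K * (2 * n) := by nlinarith
  have e5 : c * Real.exp (-(ε * r / 2)) ≤ c * (K * (2 * n)) * Real.exp (-Λ) :=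
    mul_le_mul (le_mul_of_one_le_right hc e4) e2 (Real.exp_pos _).le (by positivity)
  have e6 := mul_le_mul_of_nonneg_left e1 (mul_nonneg hc (zero_le_one.trans hK))
  have e7 := mul_lt_mul_of_pos_right hcard (Real.exp_pos (-Λ))
  rw [← Real.exp_add, add_neg_cancel, Real.exp_zero] at e7
  rw [e3]
  linarith

/-- The random code at finite length. The expected number of codewords of each message is
`L = 2 r / ε ^ 2`, where `r = 8 n Λ / ε` bounds the number of heavy points and `Λ = 9 n 2 ^ t`
exceeds the logarithm of the number of tampering functions. -/
theorem exists_isSampledNonMalleable {n t k : ℕ} (hn : 1 ≤ n) (ht : t ≤ n) (hkn : k ≤ n) {ε : ℝ}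
    (hε : 0 < ε) (hε4 : ε ≤ 1 / 4) (hsmall : 2304 * (n : ℝ) ^ 3 * 2 ^ (t + k) ≤ ε ^ 4 * 2 ^ n) :
    ∃ C : CodingScheme k n, ∀ ρr ρw : ℝ, ⌊ρr * n⌋₊ = t →
      IsSampledNonMalleable C (tamperFamily n ρr ρw) (9 * ε) 1 := by
  have hn0 : (1 : ℝ) ≤ n := by exact_mod_cast hn
  have hnpos : (0 : ℝ) < n := by linarith
  have hX : (Fintype.card (Word n) : ℝ) = 2 ^ n := by simp
  have hM : (Fintype.card (Word k) : ℝ) = 2 ^ k := by simp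
  have hJ : (Fintype.card (Fin n × Bool) : ℝ) = 2 * n := by simp [mul_comm]
  have hT : (1 : ℝ) ≤ 2 ^ t := one_le_pow₀ (by norm_num)
  obtain ⟨Λ, hΛ⟩ : ∃ Λ : ℝ, Λ = 9 * n * 2 ^ t := ⟨_, rfl⟩
  obtain ⟨r, hr⟩ : ∃ r : ℝ, r = 8 * n * Λ / ε := ⟨_, rfl⟩
  obtain ⟨p, hp⟩ : ∃ p : ℝ, p = 2 * r / ε ^ 2 / 2 ^ n := ⟨_, rfl⟩
  have hΛ9 : 9 ≤ Λ := by rw [hΛ]; nlinarith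
  have hrε : r * ε = 8 * n * Λ := by rw [hr]; field_simp
  have hr0 : 0 < r := by rw [hr]; positivity
  have hL : p * 2 ^ n = 2 * r / ε ^ 2 := by rw [hp]; field_simp
  have hp0 : 0 < p := by rw [hp]; positivity
  have hεL : ε ^ 2 * (p * 2 ^ n) = 2 * r := by rw [hL]; field_simp
  have hq : 2 ^ k * p ≤ ε / (2 * n) / 8 := by
    have : 2 ^ k * p = (2304 * (n : ℝ) ^ 3 * 2 ^ (t + k)) / (16 * n * ε ^ 3 * 2 ^ n) := by
      rw [hp, hr, hΛ, pow_add]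
      field_simp
      ring
    rw [this, div_le_iff₀ (by positivity)]
    refine hsmall.trans (le_of_eq ?_)
    field_simp
    ring
  have hq4 : 2 ^ k * p ≤ ε / 4 := by
    refine hq.trans ?_
    rw [div_div, div_le_div_iff_of_pos_left hε (by positivity) (by norm_num)]
    linarith
  have hr32 : 32 * Λ ≤ r := by
    have h1 : 8 * Λ ≤ r * ε := by rw [hrε]; nlinarith
    nlinarith
  obtain ⟨d, hd⟩ := exists_isGoodDecoder (M := Word k)
    (fun i : TamperIndex n t => bitTamperFun i.1.1.1 i.1.2 i.2)
    (fun j : Fin n × Bool => Finset.univ.filter fun x : Word n => x j.1 = j.2)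
    (fun x y hxy => by
      obtain ⟨i, hi⟩ := Function.ne_iff.1 hxy
      exact ⟨(i, x i), by simp, by simpa using Ne.symm hi⟩)
    (p := p) (ε := ε) (η := ε / (2 * n)) (r := r) hp0 (by rw [hM]; linarith) hε (by linarith) hr0
    (by
      rw [hX, hL, mul_div_assoc', le_div_iff₀ (by positivity)]
      have : ε ^ 2 ≤ 1 := pow_le_one₀ hε.le (by linarith)
      nlinarith)
    (by rwa [hM]) (by rwa [hM])
    (by
      rw [hJ]
      refine le_of_eq ?_
      field_simp)
    (by
      rw [hM, hJ, hX, hεL]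
      refine union_bound_lt_one (Nat.cast_nonneg _) (one_le_pow₀ (by norm_num)) hn0 hΛ9 hrε hr32 ?_
      rw [hΛ]
      exact card_tamperIndex_mul_lt hn hkn)
  obtain ⟨S, -, hS⟩ := Finset.exists_subset_card_eq (ht.trans_eq (Finset.card_fin n).symm)
  have hsurj : ∀ m, ∃ x, d x = some m := by
    intro m
    have h1 := (abs_le.1 ((hd ⟨(⟨S, hS⟩, ∅), fun _ _ => .keep⟩).abs_card_sub_le m)).1
    rw [hX] at h1
    have h2 : (0 : ℝ) < p * 2 ^ n := by positivity
    have h3 : (0 : ℝ) < ((Finset.univ.filter fun x => d x = some m).card : ℝ) := by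
      have := mul_le_mul_of_nonneg_right hε4 h2.le
      linarith
    obtain ⟨x, hx⟩ := Finset.card_pos.1 (Nat.cast_pos.1 h3)
    exact ⟨x, (Finset.mem_filter.1 hx).2⟩
  refine ⟨decoderScheme d hsurj, fun ρr ρw hρ =>
    ⟨oneQuerySampler d, queriesAtMost_oneQuerySampler d, ?_⟩⟩
  rintro f ⟨Sr, Sw, g, hSr, -, rfl⟩ m
  rw [statDist_oneQuerySampler]
  have := (hd ⟨(⟨Sr, hSr.trans hρ⟩, Sw), g⟩).sum_abs_le hp0 hε4 m
  linarith

/-! ### Rates and errors of the random codes -/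

/-- The scheme that pads the message with zeros. -/
noncomputable def paddingScheme {k n : ℕ} (h : k ≤ n) : CodingScheme k n where
  enc m := PMF.pure fun i => if hi : (i : ℕ) < k then m ⟨i, hi⟩ else false
  dec x := some fun i => x (Fin.castLE h i)
  correct m x hx := by
    rw [PMF.support_pure, Set.mem_singleton_iff] at hx
    subst hx
    simp

lemma isSampledNonMalleable_one {k n : ℕ} (C : CodingScheme k n) (F : Set (Word n → Word n)) :
    IsSampledNonMalleable C F 1 1 :=
  ⟨PMF.pure (.output none), fun a ha => by
    rw [PMF.support_pure, Set.mem_singleton_iff] at ha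
    subst ha
    trivial, fun _ _ _ => statDist_le_one _ _⟩

lemma IsSampledNonMalleable.mono {k n q : ℕ} {C : CodingScheme k n} {F : Set (Word n → Word n)}
    {ε ε' : ℝ} (h : IsSampledNonMalleable C F ε q) (hε : ε ≤ ε') :
    IsSampledNonMalleable C F ε' q := by
  obtain ⟨A, hA, hA'⟩ := h
  exact ⟨A, hA, fun f hf m => (hA' f hf m).trans hε⟩

lemma superpolynomialDecay_const_mul_pow {θ : ℝ} (h0 : 0 ≤ θ) (h1 : θ < 1) (c : ℝ) :
    Asymptotics.SuperpolynomialDecay atTop (fun k : ℕ => (k : ℝ)) fun k => c * θ ^ k := by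
  intro z
  have := (tendsto_pow_const_mul_const_pow_of_abs_lt_one z
    (abs_lt.2 ⟨by linarith, h1⟩)).const_mul c
  rw [mul_zero] at this
  exact this.congr fun k => by ring

/-- At rates bounded away from and below `1 - ρr`, the random code at length `n` has an error that
is exponentially small in `n`. -/
lemma exists_error_pow {ρr δ : ℝ} (hδ : 0 < δ) (hr : 0 ≤ ρr) :
    ∃ θ : ℝ, 0 < θ ∧ θ < 1 ∧ ∃ n₀, ∀ n k : ℕ, n₀ ≤ n → k ≤ n → (k : ℝ) ≤ (1 - ρr - δ) * n →
      ∃ C : CodingScheme k n, ∀ ρw,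
        IsSampledNonMalleable C (tamperFamily n ρr ρw) (9 * θ ^ n) 1 := by
  -- The error `θ ^ n` satisfies `(θ ^ n) ^ 8 = 2 ^ (-δ n)`, half of which absorbs `2304 n ^ 3`.
  set θ : ℝ := 2 ^ (-(δ / 8)) with hθ
  have hθ0 : 0 < θ := by positivity
  have hθ1 : θ < 1 := Real.rpow_lt_one_of_one_lt_of_neg (by norm_num) (by linarith)
  refine ⟨θ, hθ0, hθ1, ?_⟩
  have e1 : ∀ᶠ n : ℕ in atTop, θ ^ n < 1 / 4 :=
    (tendsto_pow_atTop_nhds_zero_of_lt_one hθ0.le hθ1).eventually_lt_const (by norm_num)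
  have e2 : ∀ᶠ n : ℕ in atTop, (n : ℝ) ^ 3 * (θ ^ 4) ^ n < 1 / 2304 := by
    have h4 : θ ^ 4 < 1 := pow_lt_one₀ hθ0.le hθ1 (by norm_num)
    refine (tendsto_pow_const_mul_const_pow_of_abs_lt_one 3 ?_).eventually_lt_const (by norm_num)
    rw [abs_of_pos (by positivity)]
    exact h4
  obtain ⟨n₀, hn₀⟩ := eventually_atTop.1 ((e1.and e2).and (eventually_ge_atTop 1))
  refine ⟨n₀, fun n k hn hkn hk => ?_⟩
  obtain ⟨⟨h1, h2⟩, h3⟩ := hn₀ n hn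
  have hn0 : (0 : ℝ) < n := by exact_mod_cast h3
  have ht : ⌊ρr * n⌋₊ ≤ n := by
    refine Nat.floor_le_of_le ?_
    have : (0 : ℝ) ≤ k := Nat.cast_nonneg k
    nlinarith
  obtain ⟨C, hC⟩ := exists_isSampledNonMalleable (t := ⌊ρr * n⌋₊) h3 ht hkn (pow_pos hθ0 n) h1.le (by
    have hpow : (2 : ℝ) ^ (⌊ρr * n⌋₊ + k) ≤ (θ ^ n) ^ 8 * 2 ^ n := by
      have h5 : ((⌊ρr * n⌋₊ + k : ℕ) : ℝ) ≤ -(δ / 8) * (n * 8 : ℕ) + n := by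
        push_cast
        have := Nat.floor_le (mul_nonneg hr (Nat.cast_nonneg n))
        linarith
      rw [← pow_mul, hθ, ← Real.rpow_natCast, ← Real.rpow_natCast (2 ^ (-(δ / 8))),
        ← Real.rpow_mul (by norm_num), ← Real.rpow_natCast 2 n, ← Real.rpow_add (by norm_num)]
      exact Real.rpow_le_rpow_of_exponent_le (by norm_num) h5
    have h6 : (n : ℝ) ^ 3 * (θ ^ n) ^ 4 ≤ 1 / 2304 := by
      rw [← pow_mul, mul_comm n, pow_mul]
      exact h2.le
    calc 2304 * (n : ℝ) ^ 3 * 2 ^ (⌊ρr * n⌋₊ + k)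
        ≤ 2304 * (n : ℝ) ^ 3 * ((θ ^ n) ^ 8 * 2 ^ n) := by gcongr
      _ = 2304 * ((n : ℝ) ^ 3 * (θ ^ n) ^ 4) * ((θ ^ n) ^ 4 * 2 ^ n) := by ring
      _ ≤ 2304 * (1 / 2304) * ((θ ^ n) ^ 4 * 2 ^ n) := by gcongr
      _ = (θ ^ n) ^ 4 * 2 ^ n := by ring)
  exact ⟨C, fun ρw => hC ρr ρw rfl⟩

lemma ofReal_le_strictCapacity {ρr R : ℝ} (ρw : ℝ) (hr : 0 ≤ ρr) (hR : 0 < R) (hR1 : R < 1 - ρr) :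
    ENNReal.ofReal R ≤ strictCapacity ρr ρw := by
  obtain ⟨θ, hθ0, hθ1, n₀, H⟩ := exists_error_pow (δ := 1 - ρr - R) (by linarith) hr
  have hkn : ∀ k : ℕ, k ≤ ⌈(k : ℝ) / R⌉₊ := fun k => by
    have h1 : (k : ℝ) ≤ k / R := le_div_self (Nat.cast_nonneg k) hR (by linarith)
    exact_mod_cast h1.trans (Nat.le_ceil _)
  have hC : ∀ k : ℕ, ∃ C : CodingScheme k ⌈(k : ℝ) / R⌉₊,
      IsSampledNonMalleable C (tamperFamily ⌈(k : ℝ) / R⌉₊ ρr ρw)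
        (max 9 (θ ^ n₀)⁻¹ * θ ^ k) 1 := by
    intro k
    by_cases hk : n₀ ≤ k
    · obtain ⟨C, hC⟩ := H ⌈(k : ℝ) / R⌉₊ k (hk.trans (hkn k)) (hkn k) (by
        have := (div_le_iff₀ hR).1 (Nat.le_ceil ((k : ℝ) / R))
        linarith)
      refine ⟨C, (hC ρw).mono ?_⟩
      exact mul_le_mul (le_max_left _ _) (pow_le_pow_of_le_one hθ0.le hθ1.le (hkn k))
        (by positivity) (by positivity)
    -- For small `k` the bound on the error exceeds one, and any scheme will do.
    · refine ⟨paddingScheme (hkn k), (isSampledNonMalleable_one _ _).mono ?_⟩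
      calc (1 : ℝ) = (θ ^ n₀)⁻¹ * θ ^ n₀ := by field_simp
        _ ≤ max 9 (θ ^ n₀)⁻¹ * θ ^ k :=
          mul_le_mul (le_max_right _ _) (pow_le_pow_of_le_one hθ0.le hθ1.le (by omega))
            (by positivity) (by positivity)
  choose C hC using hC
  have hfam : IsStrictNMCFamily ρr ρw (fun k => ⌈(k : ℝ) / R⌉₊) C :=
    ⟨fun k => max 9 (θ ^ n₀)⁻¹ * θ ^ k, 1, superpolynomialDecay_const_mul_pow hθ0.le hθ1 _,
      fun k => by simpa using hC k⟩
  refine le_iSup_of_le _ (le_iSup_of_le C (le_iSup_of_le hfam ?_))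
  have hlim : Tendsto (fun k : ℕ => ENNReal.ofReal (R - 1 / (k : ℝ))) atTop
      (𝓝 (ENNReal.ofReal R)) := by
    refine ENNReal.tendsto_ofReal ?_
    simpa using (tendsto_const_div_atTop_nhds_zero_nat (1 : ℝ)).const_sub R
  rw [← hlim.liminf_eq]
  refine liminf_le_liminf ?_
  filter_upwards [eventually_ge_atTop 1] with k hk
  have hk0 : (0 : ℝ) < k := by exact_mod_cast hk
  have hn0 : (0 : ℝ) < ⌈(k : ℝ) / R⌉₊ := by exact_mod_cast lt_of_lt_of_le hk (hkn k)
  rw [← ENNReal.ofReal_natCast, ← ENNReal.ofReal_natCast, ← ENNReal.ofReal_div_of_pos hn0]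
  refine ENNReal.ofReal_le_ofReal ?_
  have h1 : (⌈(k : ℝ) / R⌉₊ : ℝ) ≤ k / R + 1 := (Nat.ceil_lt_add_one (by positivity)).le
  have h2 : (k : ℝ) / (k / R + 1) ≤ k / ⌈(k : ℝ) / R⌉₊ := by gcongr
  refine le_trans ?_ h2
  rw [le_div_iff₀ (by positivity)]
  have h3 : (R - 1 / k) * (k / R + 1) = k - (1 / R + 1 / k - R) := by
    field_simp
    ring
  have h4 : 1 ≤ 1 / R := by rw [le_div_iff₀ hR]; linarith
  have h5 : 0 < 1 / (k : ℝ) := by positivity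
  linarith

lemma le_strictCapacity {ρr : ℝ} (ρw : ℝ) (hr : 0 ≤ ρr) :
    ENNReal.ofReal (1 - ρr) ≤ strictCapacity ρr ρw := by
  refine le_of_forall_lt fun c hc => ?_
  obtain ⟨a, ha, hca⟩ := ENNReal.lt_iff_exists_real_btwn.1 hc
  obtain ⟨hca, hlt⟩ := hca
  have ha0 : 0 < a := ENNReal.ofReal_pos.1 (bot_le.trans_lt hca)
  have hlt' : a < 1 - ρr := (ENNReal.ofReal_lt_ofReal_iff_of_nonneg ha).1 hlt
  exact hca.trans_le (ofReal_le_strictCapacity ρw hr ha0 hlt')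

end BitNMC

theorem theorem3p2 (ρr ρw : ℝ) (hr : 0 ≤ ρr) (hrw : ρr ≤ ρw) (hw : ρw ≤ 1) :
    BitNMC.capacity ρr ρw = ENNReal.ofReal (1 - ρr) ∧
      BitNMC.strictCapacity ρr ρw = ENNReal.ofReal (1 - ρr) :=
  have hle := BitNMC.capacity_le hrw hw
  have hsc := BitNMC.strictCapacity_le_capacity ρr ρw
  have hge := BitNMC.le_strictCapacity ρw hr
  ⟨le_antisymm hle (hge.trans hsc), le_antisymm (hsc.trans hle) hge⟩
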